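/- **Theorem (multiplicative Moser theorem for $k$-forms).** All manifolds are smooth and finite-dimensional. Let $\mathcal G\rightrightarrows M$ be a Lie groupoid with source $s$, target $t$, multiplication $m$ and division map $\bar m(g,h)=gh^{-1}$ (on pairs of arrows with the same source), and assume that the manifold of arrows $\mathcal G$ is compact and Hausdorff. Let $k\ge 0$. A $k$-form $\omega$ on $\mathcal G$ is multiplicative if $m^*\omega=\mathrm{pr}_1^*\omega+\mathrm{pr}_2^*\omega$ on $\mathcal G^{(2)}=\{(g,h): s(g)=t(h)\}$. Let $I\subseteq\mathbb R$ be an open interval containing $0$, and let $(\omega_\varepsilon)_{\varepsilon\in I}$ be a deformation of the multiplicative $k$-form $\omega$, that is, a family of multiplicative $k$-forms with $\omega_0=\omega$ such that $(\varepsilon,v)\mapsto\hat\omega_\varepsilon(v)$ is a smooth function on $I\times\bigoplus^kT\mathcal G$, where $\hat\omega_\varepsilon:\bigoplus^kT\mathcal G\to\mathbb R$ denotes $\omega_\varepsilon$ regarded as a fibrewise $k$-linear skew-symmetric function. Let $Z^1_{def}(\mathcal G)$ be the space of deformation $1$-cocycles of $\mathcal G$, i.e. multiplicative vector fields: smooth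 vector fields $Z$ on $\mathcal G$ that are $s$-projectable and satisfy $Z(g)=T\bar m(Z(gh),Z(h))$ for all $(g,h)\in\mathcal G^{(2)}$. For such $Z$ let $\mathcal T Z$ be the vector field on $\bigoplus^kT\mathcal G$ whose value at $(v_1,\dots,v_k)$ is $(J(TZ(v_1)),\dots,J(TZ(v_k)))$, where $J$ is the canonical involution of $T(T\mathcal G)$, and let $(\hat\omega_\varepsilon)_*(\mathcal TZ)=d\hat\omega_\varepsilon\circ\mathcal TZ:\bigoplus^kT\mathcal G\to\mathbb R$. Then the following are equivalent: 1. there is a smooth family $(\Phi_\varepsilon)_{\varepsilon\in I}$ of Lie groupoid automorphisms of $\mathcal G$ with $\Phi_0=\mathrm{Id}_{\mathcal G}$ and $\omega_\varepsilon=\Phi_\varepsilon^*\omega$ for all $\varepsilon\in I$; 2. the family $\frac{d}{d\varepsilon}\omega_\varepsilon$ has a smooth pre-image in $Z^1_{def}(\mathcal G)$ under $(\hat\omega_\varepsilon)_*\circ\mathcal T$: there is a family $Z_\varepsilon\in Z^1_{def}(\mathcal G)$, $\varepsilon\in I$, of multiplicative vector fields, smooth in $(\varepsilon,g)\in I\times\mathcal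 G$, with $(\hat\omega_\varepsilon)_*(\mathcal T Z_\varepsilon)=\frac{d}{d\varepsilon}\omega_\varepsilon$ for all $\varepsilon\in I$. -/

import Mathlib

open Set
open scoped Manifold ContDiff Bundle

noncomputable section

universe u v w₁ w₂

/-- A (smooth, finite-dimensional when the model spaces are) Lie groupoid `G ⇉ M`: the manifold of
arrows `G` is modelled on `E`, the manifold of objects `M` is modelled on `E₀`. An arrow `g` goes
from `src g` to `tgt g`, and `mul g h` is meaningful when `src g = tgt h`; the values of `mul` off
the composable pairs are irrelevant. Since the source is a submersion, the set of composable pairs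
is an embedded submanifold of `G × G`, and smoothness of the multiplication on this submanifold is
`ContMDiffOn`. -/
structure LieGroupoid (E : Type u) [NormedAddCommGroup E] [NormedSpace ℝ E]
    (E₀ : Type v) [NormedAddCommGroup E₀] [NormedSpace ℝ E₀]
    (G : Type w₁) [TopologicalSpace G] [ChartedSpace E G]
    (M : Type w₂) [TopologicalSpace M] [ChartedSpace E₀ M] where
  src : G → M
  tgt : G → M
  unit : M → G
  inv : G → G
  mul : G → G → G
  src_unit : ∀ x, src (unit x) = x
  tgt_unit : ∀ x, tgt (unit x) = x
  src_inv : ∀ g, src (inv g) = tgt g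
  tgt_inv : ∀ g, tgt (inv g) = src g
  src_mul : ∀ g h, src g = tgt h → src (mul g h) = src h
  tgt_mul : ∀ g h, src g = tgt h → tgt (mul g h) = tgt g
  mul_assoc : ∀ g h l, src g = tgt h → src h = tgt l → mul (mul g h) l = mul g (mul h l)
  mul_unit : ∀ g, mul g (unit (src g)) = g
  unit_mul : ∀ g, mul (unit (tgt g)) g = g
  mul_inv : ∀ g, mul g (inv g) = unit (tgt g)
  inv_mul : ∀ g, mul (inv g) g = unit (src g)
  contMDiff_src : ContMDiff 𝓘(ℝ, E) 𝓘(ℝ, E₀) ∞ src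
  contMDiff_tgt : ContMDiff 𝓘(ℝ, E) 𝓘(ℝ, E₀) ∞ tgt
  contMDiff_unit : ContMDiff 𝓘(ℝ, E₀) 𝓘(ℝ, E) ∞ unit
  contMDiff_inv : ContMDiff 𝓘(ℝ, E) 𝓘(ℝ, E) ∞ inv
  contMDiffOn_mul : ContMDiffOn (𝓘(ℝ, E).prod 𝓘(ℝ, E)) 𝓘(ℝ, E) ∞
    (fun p : G × G => mul p.1 p.2) {p | src p.1 = tgt p.2}
  isSubmersion_src : Manifold.IsSubmersion 𝓘(ℝ, E) 𝓘(ℝ, E₀) ∞ src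

/-- Differential forms of degree `k` on `G` (smoothness is imposed separately). -/
abbrev KForm (E : Type u) [NormedAddCommGroup E] [NormedSpace ℝ E]
    (G : Type w₁) [TopologicalSpace G] [ChartedSpace E G] (k : ℕ) : Type (max w₁ u) :=
  (g : G) → TangentSpace 𝓘(ℝ, E) g [⋀^Fin k]→L[ℝ] ℝ

section TangentPower

/-- The diagonal action of a linear map on `k`-tuples, as a continuous linear map. -/
def diagonalCLM (E : Type u) [NormedAddCommGroup E] [NormedSpace ℝ E] (k : ℕ) :
    (E →L[ℝ] E) →L[ℝ] ((Fin k → E) →L[ℝ] (Fin k → E)) :=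
  ((ContinuousLinearMap.piEquivL ℝ (Fin k → E) (fun _ : Fin k => E)) :
      (Fin k → ((Fin k → E) →L[ℝ] E)) →L[ℝ] _).comp
    (ContinuousLinearMap.pi fun a =>
      (ContinuousLinearMap.compL ℝ (Fin k → E) E E).flip (ContinuousLinearMap.proj a))

theorem diagonalCLM_apply (E : Type u) [NormedAddCommGroup E] [NormedSpace ℝ E] (k : ℕ)
    (A : E →L[ℝ] E) (v : Fin k → E) (a : Fin k) : diagonalCLM E k A v a = A (v a) := rfl

variable (E : Type u) [NormedAddCommGroup E] [NormedSpace ℝ E]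
  (G : Type w₁) [TopologicalSpace G] [ChartedSpace E G] [IsManifold 𝓘(ℝ, E) ∞ G]

/-- The vector bundle `⊕ᵏ TG → G`: its changes of coordinates are those of `TG`, acting on each of
the `k` summands. Its fibre at `g` consists of the `k`-tuples of tangent vectors at `g`. -/
def tangentPowerCore (k : ℕ) : VectorBundleCore ℝ G (Fin k → E) (atlas E G) where
  baseSet := (tangentBundleCore 𝓘(ℝ, E) G).baseSet
  isOpen_baseSet := (tangentBundleCore 𝓘(ℝ, E) G).isOpen_baseSet
  indexAt := (tangentBundleCore 𝓘(ℝ, E) G).indexAt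
  mem_baseSet_at := (tangentBundleCore 𝓘(ℝ, E) G).mem_baseSet_at
  coordChange i j x := diagonalCLM E k ((tangentBundleCore 𝓘(ℝ, E) G).coordChange i j x)
  coordChange_self i x hx v := by
    ext a
    exact (tangentBundleCore 𝓘(ℝ, E) G).coordChange_self i x hx (v a)
  continuousOn_coordChange i j :=
    (diagonalCLM E k).continuous.comp_continuousOn
      ((tangentBundleCore 𝓘(ℝ, E) G).continuousOn_coordChange i j)
  coordChange_comp i j l x hx v := by
    ext a
    exact (tangentBundleCore 𝓘(ℝ, E) G).coordChange_comp i j l x hx (v a)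

instance (k : ℕ) : (tangentPowerCore E G k).IsContMDiff 𝓘(ℝ, E) ∞ where
  contMDiffOn_coordChange i j := by
    have h : IsManifold 𝓘(ℝ, E) (∞ + 1) G := ‹IsManifold 𝓘(ℝ, E) ∞ G›
    have := (tangentBundleCore.isContMDiff (I := 𝓘(ℝ, E)) (M := G) (n := ∞)).1 i j
    exact (diagonalCLM E k).contMDiff.comp_contMDiffOn this

/-- The total space of `⊕ᵏ TG`, a manifold modelled on `E × (Fin k → E)`. A point is `⟨g, v⟩`
with `v` a `k`-tuple of vectors tangent to `G` at `g`. -/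
abbrev TangentPower (k : ℕ) : Type (max w₁ u) := (tangentPowerCore E G k).TotalSpace

end TangentPower

section Forms

variable {E : Type u} [NormedAddCommGroup E] [NormedSpace ℝ E]
  {G : Type w₁} [TopologicalSpace G] [ChartedSpace E G] {k : ℕ}

/-- The pull-back `φ^*α` of a form. -/
def KForm.pullback (φ : G → G) (α : KForm E G k) : KForm E G k := fun g =>
  (α (φ g)).compContinuousLinearMap (mfderiv 𝓘(ℝ, E) 𝓘(ℝ, E) φ g)

variable [IsManifold 𝓘(ℝ, E) ∞ G]

/-- The fibrewise `k`-linear skew-symmetric function on `⊕ᵏ TG` given by a `k`-form. -/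
def KForm.hat (α : KForm E G k) : TangentPower E G k → ℝ := fun p => α p.1 p.2

/-- The family `α ε`, `ε ∈ J`, of `k`-forms is smooth: it is a smooth function on
`J × ⊕ᵏ TG`. -/
def IsSmoothFormFamily (J : Set ℝ) (α : ℝ → KForm E G k) : Prop :=
  ContMDiffOn (𝓘(ℝ, ℝ).prod (𝓘(ℝ, E).prod 𝓘(ℝ, Fin k → E))) 𝓘(ℝ, ℝ) ∞
    (fun q : ℝ × TangentPower E G k => (α q.1).hat q.2) (J ×ˢ univ)

/-- The family `Z ε`, `ε ∈ J`, of vector fields on `G` is smooth: it is smooth in the pair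
`(ε, g)`, as a map with values in `TG`. -/
def IsSmoothVectorFieldFamily (J : Set ℝ) (Z : ℝ → (g : G) → TangentSpace 𝓘(ℝ, E) g) : Prop :=
  ContMDiffOn (𝓘(ℝ, ℝ).prod 𝓘(ℝ, E)) 𝓘(ℝ, E).tangent ∞
    (fun q : ℝ × G => (⟨q.2, Z q.1 q.2⟩ : TangentBundle 𝓘(ℝ, E) G)) (J ×ˢ univ)

variable (E G) in
/-- The canonical involution of the double tangent bundle. A point of `T(TG)` is written
`⟨⟨x, v⟩, (a, b)⟩`, where `v` is read in the preferred chart of `G` at `x`, and the velocity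
`(a, b)` in the chart of `TG` induced by that chart; the involution exchanges `v` and `a`. -/
def canonicalInvolution (p : TangentBundle 𝓘(ℝ, E).tangent (TangentBundle 𝓘(ℝ, E) G)) :
    TangentBundle 𝓘(ℝ, E).tangent (TangentBundle 𝓘(ℝ, E) G) :=
  let v : E := p.1.2
  let w : E × E := p.2
  ⟨⟨p.1.1, w.1⟩, ((v, w.2) : E × E)⟩

/-- The tangent lift `J ∘ TZ : TG → T(TG)` of a vector field `Z`. -/
def tangentLift (Z : (g : G) → TangentSpace 𝓘(ℝ, E) g) (v : TangentBundle 𝓘(ℝ, E) G) :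
    TangentBundle 𝓘(ℝ, E).tangent (TangentBundle 𝓘(ℝ, E) G) :=
  canonicalInvolution E G (tangentMap 𝓘(ℝ, E) 𝓘(ℝ, E).tangent
    (fun g => (⟨g, Z g⟩ : TangentBundle 𝓘(ℝ, E) G)) v)

/-- In the preferred charts the derivative of `TG → G` is the first projection. -/
theorem hasMFDerivAt_tangentBundle_proj (p : TangentBundle 𝓘(ℝ, E) G) :
    HasMFDerivAt 𝓘(ℝ, E).tangent 𝓘(ℝ, E)
      (fun q : TangentBundle 𝓘(ℝ, E) G => q.1) p (ContinuousLinearMap.fst ℝ E E) := by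
  refine ⟨FiberBundle.continuous_proj E _ |>.continuousAt, ?_⟩
  refine HasFDerivWithinAt.congr_of_eventuallyEq (f := fun q : E × E => q.1) hasFDerivWithinAt_fst ?_ ?_
  · filter_upwards [extChartAt_target_mem_nhdsWithin (I := 𝓘(ℝ, E).tangent) p] with q hq
    have hq' : q.1 ∈ (chartAt E p.1).target :=
      (TangentBundle.mem_chart_target_iff (I := 𝓘(ℝ, E)) q p).1 (by simp [mfld_simps] at hq; exact hq)
    simp [writtenInExtChartAt, mfld_simps]
    exact (chartAt E p.1).right_inv hq'
  · simp [writtenInExtChartAt, mfld_simps]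
    exact (chartAt E p.1).right_inv (mem_chart_target E p.1)

/-- The tangent lift at `v` is tangent to `TG` at `v`. -/
theorem tangentLift_base (Z : (g : G) → TangentSpace 𝓘(ℝ, E) g) (v : TangentBundle 𝓘(ℝ, E) G)
    (hZ : MDifferentiableAt 𝓘(ℝ, E) 𝓘(ℝ, E).tangent
      (fun g => (⟨g, Z g⟩ : TangentBundle 𝓘(ℝ, E) G)) v.1) :
    (tangentLift Z v).1 = v := by
  have h := (hasMFDerivAt_tangentBundle_proj (⟨v.1, Z v.1⟩ : TangentBundle 𝓘(ℝ, E) G)).comp v.1 hZ.hasMFDerivAt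
  have h' : HasMFDerivAt 𝓘(ℝ, E) 𝓘(ℝ, E) (fun g : G => g) v.1 _ := h
  have e := hasMFDerivAt_unique h' (hasMFDerivAt_id v.1)
  have e' := congrArg (fun L : E →L[ℝ] E => L v.2) e
  exact congrArg (fun a : E => (⟨v.1, a⟩ : TangentBundle 𝓘(ℝ, E) G)) e'

/-- The tangent lift at `v` projects to `Z`. -/
theorem tangentLift_velocity (Z : (g : G) → TangentSpace 𝓘(ℝ, E) g)
    (v : TangentBundle 𝓘(ℝ, E) G) :
    ((tangentLift Z v).2 : E × E).1 = Z v.1 := rfl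

/-- `𝒯 Z = ⊕ᵏ(J ∘ TZ)`, a vector field on `⊕ᵏ TG`. At `(v₁, …, v_k)` over `g` it is the tuple of the
vectors `J(TZ(vᵢ))`, tangent to `TG` at `vᵢ`, which have the same projection `Z g` to `TG`. As a
vector tangent to the total space `⊕ᵏ TG` it consists of this projection and of the
`k` fibre components. -/
def tangentPowerLift (k : ℕ) (Z : (g : G) → TangentSpace 𝓘(ℝ, E) g) (p : TangentPower E G k) :
    TangentSpace (𝓘(ℝ, E).prod 𝓘(ℝ, Fin k → E)) p :=
  ((Z p.1, fun i =>
    ((tangentLift Z (⟨p.1, (p.2 : Fin k → E) i⟩ : TangentBundle 𝓘(ℝ, E) G)).2 : E × E).2) :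
      E × (Fin k → E))

/-- The push-forward `(α̂)_* c = dα̂ ∘ c` of a vector field `c` on `⊕ᵏ TG` by
`α̂ : ⊕ᵏ TG → ℝ`, where `Tℝ` is identified with `ℝ × ℝ` and projected to the second factor. -/
def KForm.push (α : KForm E G k)
    (c : (p : TangentPower E G k) → TangentSpace (𝓘(ℝ, E).prod 𝓘(ℝ, Fin k → E)) p)
    (p : TangentPower E G k) : ℝ :=
  mfderiv (𝓘(ℝ, E).prod 𝓘(ℝ, Fin k → E)) 𝓘(ℝ, ℝ) α.hat p (c p)

end Forms

namespace LieGroupoid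

variable {E : Type u} [NormedAddCommGroup E] [NormedSpace ℝ E]
  {E₀ : Type v} [NormedAddCommGroup E₀] [NormedSpace ℝ E₀]
  {G : Type w₁} [TopologicalSpace G] [ChartedSpace E G]
  {M : Type w₂} [TopologicalSpace M] [ChartedSpace E₀ M]
  (𝒢 : LieGroupoid E E₀ G M)

/-- The composable pairs `G⁽²⁾`. -/
def composable : Set (G × G) := {p | 𝒢.src p.1 = 𝒢.tgt p.2}

/-- The pairs of arrows with the same source. -/
def divisible : Set (G × G) := {p | 𝒢.src p.1 = 𝒢.src p.2}

/-- The division map `(g, h) ↦ g h⁻¹`, on pairs with the same source. -/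
def div (p : G × G) : G := 𝒢.mul p.1 (𝒢.inv p.2)

/-- If `a`, `b` are curves with `a t`, `b t` composable and velocities `v`, `w` at `0`, then the
tangent map of the multiplication, computed within `G⁽²⁾`, sends `(v, w)` to the velocity of the
product curve. -/
theorem mfderivWithin_mul_eq [IsManifold 𝓘(ℝ, E) ∞ G] (a b : ℝ → G)
    (hc : ∀ t, 𝒢.src (a t) = 𝒢.tgt (b t)) (v w : E)
    (ha : HasMFDerivAt 𝓘(ℝ, ℝ) 𝓘(ℝ, E) a 0 (ContinuousLinearMap.toSpanSingleton ℝ v))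
    (hb : HasMFDerivAt 𝓘(ℝ, ℝ) 𝓘(ℝ, E) b 0 (ContinuousLinearMap.toSpanSingleton ℝ w)) :
    mfderiv 𝓘(ℝ, ℝ) 𝓘(ℝ, E) (fun t => 𝒢.mul (a t) (b t)) 0 (1 : ℝ) =
      mfderivWithin (𝓘(ℝ, E).prod 𝓘(ℝ, E)) 𝓘(ℝ, E)
        (fun p : G × G => 𝒢.mul p.1 p.2) 𝒢.composable (a 0, b 0) ((v, w) : E × E) := by
  have hm := (𝒢.contMDiffOn_mul.mdifferentiableOn (by simp) (a 0, b 0) (hc 0)).hasMFDerivWithinAt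
  have hab := (ha.prodMk hb).hasMFDerivWithinAt (s := univ)
  have h := HasMFDerivWithinAt.comp (0 : ℝ) hm hab
    (show univ ⊆ (fun t => (a t, b t)) ⁻¹' {p : G × G | 𝒢.src p.1 = 𝒢.tgt p.2} from
      fun t _ => hc t)
  have h' := hasMFDerivWithinAt_univ.1 h
  have e1 : (ContinuousLinearMap.toSpanSingleton ℝ v) (1 : ℝ) = v := by simp
  have e2 : (ContinuousLinearMap.toSpanSingleton ℝ w) (1 : ℝ) = w := by simp
  refine (congrArg (fun L : ℝ →L[ℝ] E => L 1) h'.mfderiv).trans ?_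
  show (mfderivWithin (𝓘(ℝ, E).prod 𝓘(ℝ, E)) 𝓘(ℝ, E)
    (fun p : G × G => 𝒢.mul p.1 p.2) 𝒢.composable (a 0, b 0))
      ((ContinuousLinearMap.toSpanSingleton ℝ v) (1 : ℝ),
        (ContinuousLinearMap.toSpanSingleton ℝ w) (1 : ℝ)) = _
  rw [e1, e2]

/-- Multiplicativity `m^*α = pr₁^*α + pr₂^*α` on `G⁽²⁾`. The vectors tangent to `G⁽²⁾` at `(g, h)`
are the pairs `(v, w)` with `Ts(v) = Tt(w)`; on these, any derivative of the multiplication within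
the submanifold `G⁽²⁾` takes the same value, so that `mfderivWithin` is the tangent map there. -/
def IsMultiplicative {k : ℕ} (α : KForm E G k) : Prop :=
  ∀ g h : G, 𝒢.src g = 𝒢.tgt h →
    ∀ (v : Fin k → TangentSpace 𝓘(ℝ, E) g) (w : Fin k → TangentSpace 𝓘(ℝ, E) h),
      (∀ i, tangentMap 𝓘(ℝ, E) 𝓘(ℝ, E₀) 𝒢.src ⟨g, v i⟩ =
        tangentMap 𝓘(ℝ, E) 𝓘(ℝ, E₀) 𝒢.tgt ⟨h, w i⟩) →
      α (𝒢.mul g h) (fun i => mfderivWithin (𝓘(ℝ, E).prod 𝓘(ℝ, E)) 𝓘(ℝ, E)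
        (fun p : G × G => 𝒢.mul p.1 p.2) 𝒢.composable (g, h) ((v i, w i) : E × E)) =
      α g v + α h w

/-- A deformation of the multiplicative `k`-form `α₀`, over the interval `J`: a smooth family of
multiplicative `k`-forms with value `α₀` at `0`. -/
structure IsDeformation [IsManifold 𝓘(ℝ, E) ∞ G] {k : ℕ} (J : Set ℝ) (α₀ : KForm E G k)
    (α : ℝ → KForm E G k) : Prop where
  smooth : IsSmoothFormFamily J α
  multiplicative : ∀ ε ∈ J, 𝒢.IsMultiplicative (α ε)
  zero : α 0 = α₀

/-- Automorphisms of the Lie groupoid: diffeomorphisms of the arrows, over a diffeomorphism of the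
objects, that respect source, target and multiplication (hence units and inverses). -/
def IsAutomorphism (Φ : G → G) : Prop :=
  ∃ (F : G ≃ₘ^∞⟮𝓘(ℝ, E), 𝓘(ℝ, E)⟯ G) (f : M ≃ₘ^∞⟮𝓘(ℝ, E₀), 𝓘(ℝ, E₀)⟯ M),
    (∀ g, Φ g = F g) ∧ (∀ g, 𝒢.src (Φ g) = f (𝒢.src g)) ∧ (∀ g, 𝒢.tgt (Φ g) = f (𝒢.tgt g)) ∧
    ∀ g h, 𝒢.src g = 𝒢.tgt h → Φ (𝒢.mul g h) = 𝒢.mul (Φ g) (Φ h)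

/-- A smooth family `Φ ε`, `ε ∈ J`, of automorphisms of the Lie groupoid. -/
def IsSmoothAutomorphismFamily (J : Set ℝ) (Φ : ℝ → G → G) : Prop :=
  ContMDiffOn (𝓘(ℝ, ℝ).prod 𝓘(ℝ, E)) 𝓘(ℝ, E) ∞ (fun q : ℝ × G => Φ q.1 q.2) (J ×ˢ univ) ∧
    ∀ ε ∈ J, 𝒢.IsAutomorphism (Φ ε)

/-- The vector field `Z` is source-projectable. -/
def IsSrcProjectable (Z : (g : G) → TangentSpace 𝓘(ℝ, E) g) : Prop :=
  ∃ V : (x : M) → TangentSpace 𝓘(ℝ, E₀) x,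
    ∀ g, mfderiv 𝓘(ℝ, E) 𝓘(ℝ, E₀) 𝒢.src g (Z g) = V (𝒢.src g)

/-- The vector field `Z` is a `1`-cocycle of the deformation complex of the groupoid, that is, a
multiplicative vector field: it is source-projectable, and
`(δZ)(g, h) = -Tm̄(Z(gh), Z(h)) + Z(g)` vanishes for all composable `g`, `h`, where `m̄` is the
division map. -/
def IsDeformationCocycle (Z : (g : G) → TangentSpace 𝓘(ℝ, E) g) : Prop :=
  𝒢.IsSrcProjectable Z ∧ ∀ g h : G, 𝒢.src g = 𝒢.tgt h →
    (⟨𝒢.div (𝒢.mul g h, h), mfderivWithin (𝓘(ℝ, E).prod 𝓘(ℝ, E)) 𝓘(ℝ, E) 𝒢.div 𝒢.divisible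
      (𝒢.mul g h, h) ((Z (𝒢.mul g h), Z h) : E × E)⟩ : TangentBundle 𝓘(ℝ, E) G) = ⟨g, Z g⟩

end LieGroupoid

end

/-! The engine is the Lie derivative formula (`IsSmoothFormFamily.hasDerivAt_pullback`). If a family
of maps `Ψ τ` passes through the identity at time `t` with velocity `Y`, then the derivative of `(Ψ
τ)^* α τ` at `t` is `α' t + L_Y (α t)`, where `L_Y` is given by `push` of the tangent lift of `Y`.
In a chart this is the chain rule together with the symmetry of the mixed second derivatives of `Ψ`,
which is what the canonical involution encodes.

From vector fields to automorphisms, let `P t s` be the evolution of `-Z` from time `s` to time `t`,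
which exists on all of `J` because `G` is compact (`IsSmoothVectorFieldFamily.exists_evolution`).
Since `L_{Z τ} (α τ) = α' τ`, the pull-back `(P τ ε)^* α τ` does not depend on `τ`. Comparing `τ =
ε` with `τ = 0` gives `α ε = (P 0 ε)^* α₀`, so `Φ ε = P 0 ε` works. These maps are automorphisms by
uniqueness of solutions: projecting to the objects, or dividing, turns solutions into solutions
because the fields are multiplicative (`isAutomorphism_evolution`).

From automorphisms to vector fields, put `Z ε = (TΦ ε)⁻¹ (dΦ ε/dε)`, the velocity at `τ = ε` of `Ψ τ
= (Φ ε)⁻¹ ∘ Φ τ`. Each `Ψ τ` is an automorphism, so differentiating its compatibility with source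
and division shows that `Z ε` is a cocycle. Differentiating `α τ = (Ψ τ)^* α ε` at `τ = ε` gives the
required equation.

Smooth dependence of solutions on time and initial point is proved from the inverse function theorem
on the Banach space of continuous curves. -/

noncomputable section

universe u v w₁ w₂

/-! ### Smooth local flows on Banach spaces, via the inverse function theorem -/

section LocalFlow

open Filter Topology MeasureTheory

/-- Pointwise application of a bilinear map to continuous functions. -/
def pointwiseBilinear (K : Type*) [TopologicalSpace K] [CompactSpace K] {X Y Z : Type*}
    [NormedAddCommGroup X] [NormedSpace ℝ X] [NormedAddCommGroup Y] [NormedSpace ℝ Y]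
    [NormedAddCommGroup Z] [NormedSpace ℝ Z] (B : Z →L[ℝ] X →L[ℝ] Y) :
    C(K, Z) →L[ℝ] C(K, X) →L[ℝ] C(K, Y) :=
  LinearMap.mkContinuous₂
    (LinearMap.mk₂ ℝ
      (fun (A : C(K, Z)) (h : C(K, X)) =>
        (⟨fun x => B (A x) (h x), by fun_prop⟩ : C(K, Y)))
      (fun A B h => by ext x; simp) (fun c A h => by ext x; simp)
      (fun A h l => by ext x; simp) (fun c A h => by ext x; simp)) ‖B‖
    (fun A h => by
      refine (ContinuousMap.norm_le _ (by positivity)).2 fun x => ?_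
      refine (B.le_opNorm₂ (A x) (h x)).trans ?_
      have h1 := A.norm_coe_le_norm x
      have h2 := h.norm_coe_le_norm x
      gcongr)

/-- Pointwise application of a continuous family of operators to a continuous function. -/
def pointwiseApplyCLM (K : Type*) [TopologicalSpace K] [CompactSpace K]
    (X Y : Type*) [NormedAddCommGroup X] [NormedSpace ℝ X] [NormedAddCommGroup Y] [NormedSpace ℝ Y] :
    C(K, X →L[ℝ] Y) →L[ℝ] C(K, X) →L[ℝ] C(K, Y) :=
  pointwiseBilinear K (ContinuousLinearMap.id ℝ (X →L[ℝ] Y))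

set_option synthInstance.maxHeartbeats 200000 in
/-- Composition with a `C¹` map is differentiable on the space of continuous functions. -/
theorem hasFDerivAt_continuousMap_comp {K : Type*} [TopologicalSpace K] [CompactSpace K]
    {X Y : Type*} [NormedAddCommGroup X] [NormedSpace ℝ X] [NormedAddCommGroup Y] [NormedSpace ℝ Y]
    {f : X → Y} (hf : ContDiff ℝ 1 f) (γ : C(K, X)) :
    HasFDerivAt (fun γ : C(K, X) => (⟨f, hf.continuous⟩ : C(X, Y)).comp γ)
      (pointwiseApplyCLM K X Y
        ((⟨fderiv ℝ f, hf.continuous_fderiv one_ne_zero⟩ : C(X, X →L[ℝ] Y)).comp γ)) γ := by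
  rw [hasFDerivAt_iff_isLittleO_nhds_zero, Asymptotics.isLittleO_iff]
  intro c hc
  have hK : IsCompact (range γ) := isCompact_range γ.continuous
  -- The range of `γ` is compact, so `fderiv ℝ f` varies by less than `c` within a distance `δ` that
  -- serves all points of it; the mean value inequality is then uniform in `x`.
  have hu := hK.uniformContinuousAt_of_continuousAt (fderiv ℝ f)
    (fun x _ => (hf.continuous_fderiv one_ne_zero).continuousAt) (Metric.dist_mem_uniformity hc)
  obtain ⟨δ, hδ, hu⟩ := Metric.mem_uniformity_dist.1 hu
  filter_upwards [Metric.ball_mem_nhds (0 : C(K, X)) hδ] with h hh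
  rw [mem_ball_zero_iff] at hh
  refine (ContinuousMap.norm_le _ (by positivity)).2 fun x => ?_
  have key : ‖f (γ x + h x) - f (γ x) - fderiv ℝ f (γ x) (γ x + h x - γ x)‖ ≤
      c * ‖γ x + h x - γ x‖ := by
    refine Convex.norm_image_sub_le_of_norm_hasFDerivWithin_le' (s := Metric.ball (γ x) δ)
      (fun y _ => (hf.differentiable one_ne_zero y).hasFDerivAt.hasFDerivWithinAt) ?_
      (convex_ball _ _) (Metric.mem_ball_self hδ) ?_
    · intro y hy
      have := @hu (γ x) y (by rwa [dist_comm]) (mem_range_self x)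
      exact (dist_eq_norm (fderiv ℝ f y) (fderiv ℝ f (γ x))) ▸ (dist_comm (fderiv ℝ f y) _).trans_le (le_of_lt this)
    · rw [Metric.mem_ball, dist_eq_norm, add_sub_cancel_left]
      exact (h.norm_coe_le_norm x).trans_lt hh
  rw [add_sub_cancel_left] at key
  exact key.trans (mul_le_mul_of_nonneg_left (h.norm_coe_le_norm x) hc.le)

set_option synthInstance.maxHeartbeats 200000 in
/-- Composition with a `Cⁿ` map is `Cⁿ` on the space of continuous functions. -/
theorem ContDiff.continuousMap_comp {K : Type*} [TopologicalSpace K] [CompactSpace K]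
    {X Y : Type u} [NormedAddCommGroup X] [NormedSpace ℝ X] [NormedAddCommGroup Y]
    [NormedSpace ℝ Y] {n : ℕ} {f : X → Y} (hf : ContDiff ℝ n f) :
    ContDiff ℝ n (fun γ : C(K, X) => (⟨f, hf.continuous⟩ : C(X, Y)).comp γ) := by
  -- The derivative of composition with `f` is composition with `fderiv ℝ f` followed by a
  -- continuous linear operator. The target changes from `Y` to `X →L[ℝ] Y`, hence the
  -- generalization and the common universe of `X` and `Y`.
  induction n generalizing Y with
  | zero => 
    exact contDiff_zero.2 (ContinuousMap.continuous_postcomp (⟨f, hf.continuous⟩ : C(X, Y)))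
  | succ n ih =>
    have h1 : ContDiff ℝ 1 f := hf.of_le (by norm_cast; omega)
    have hd := fun γ => hasFDerivAt_continuousMap_comp (K := K) h1 γ
    have hf' : ContDiff ℝ ((n : WithTop ℕ∞) + 1) f := by exact_mod_cast hf
    have h2 : ContDiff ℝ n (fderiv ℝ f) := (contDiff_succ_iff_fderiv.1 hf').2.2
    push_cast
    refine contDiff_succ_iff_fderiv.2 ⟨fun γ => (hd γ).differentiableAt, by simp, ?_⟩
    have e : fderiv ℝ (fun γ : C(K, X) => (⟨f, hf.continuous⟩ : C(X, Y)).comp γ) =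
        fun γ => pointwiseApplyCLM K X Y
          ((⟨fderiv ℝ f, h2.continuous⟩ : C(X, X →L[ℝ] Y)).comp γ) :=
      funext fun γ => (hd γ).fderiv
    rw [e]
    exact (pointwiseApplyCLM K X Y).contDiff.comp (ih h2)

/-- The primitive vanishing at `0`, as an operator on continuous functions on `[0, 1]`. -/
def primitiveCLM (X : Type*) [NormedAddCommGroup X] [NormedSpace ℝ X] [CompleteSpace X] :
    C(unitInterval, X) →L[ℝ] C(unitInterval, X) :=
  LinearMap.mkContinuous
    { toFun := fun γ => ⟨fun σ => ∫ τ in (0 : ℝ)..σ, IccExtend zero_le_one γ τ,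
        (intervalIntegral.continuous_primitive
          (fun a b => (γ.continuous.Icc_extend' (h := zero_le_one)).intervalIntegrable a b) 0).comp
            continuous_subtype_val⟩
      map_add' := fun γ η => by
        ext σ
        exact intervalIntegral.integral_add
          ((γ.continuous.Icc_extend' (h := zero_le_one)).intervalIntegrable 0 σ)
          ((η.continuous.Icc_extend' (h := zero_le_one)).intervalIntegrable 0 σ)
      map_smul' := fun c γ => by
        ext σ
        exact intervalIntegral.integral_smul c (IccExtend zero_le_one γ) } 1
    (fun γ => by
      rw [one_mul]
      refine (ContinuousMap.norm_le _ (norm_nonneg _)).2 fun σ => ?_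
      have := intervalIntegral.norm_integral_le_of_norm_le_const (a := 0) (b := σ)
        (f := IccExtend zero_le_one γ) (C := ‖γ‖) (fun τ _ => γ.norm_coe_le_norm _)
      refine this.trans (mul_le_of_le_one_right (norm_nonneg _) ?_)
      rw [sub_zero, abs_of_nonneg σ.2.1]
      exact σ.2.2)

theorem primitiveCLM_apply {X : Type*} [NormedAddCommGroup X] [NormedSpace ℝ X] [CompleteSpace X]
    (γ : C(unitInterval, X)) (σ : unitInterval) :
    primitiveCLM X γ σ = ∫ τ in (0 : ℝ)..σ, IccExtend zero_le_one γ τ := rfl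

/-- Change of variables in the integral. It shows that slowing a curve down by the factor `σ` turns
a solution of the rescaled integral equation for time `t` into one for time `σ * t`. -/
theorem primitiveCLM_comp_mul {X : Type*} [NormedAddCommGroup X] [NormedSpace ℝ X]
    [CompleteSpace X] (γ : C(unitInterval, X)) (σ ρ : unitInterval) :
    (σ : ℝ) • primitiveCLM X (γ.comp ⟨fun τ => σ * τ, by fun_prop⟩) ρ =
      primitiveCLM X γ (σ * ρ) := by
  rw [primitiveCLM_apply, primitiveCLM_apply]
  have h := intervalIntegral.smul_integral_comp_mul_left (a := 0) (b := ρ)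
    (IccExtend zero_le_one γ) (σ : ℝ)
  rw [mul_zero] at h
  refine Eq.trans ?_ h
  congr 1
  refine intervalIntegral.integral_congr fun τ hτ => ?_
  rw [uIcc_of_le ρ.2.1] at hτ
  have hτ' : τ ∈ Icc (0 : ℝ) 1 := ⟨hτ.1, hτ.2.trans ρ.2.2⟩
  have hm : (σ : ℝ) * τ ∈ Icc (0 : ℝ) 1 := (σ * ⟨τ, hτ'⟩ : unitInterval).2
  simp only [IccExtend_of_mem _ _ hτ', IccExtend_of_mem _ _ hm]
  rfl

/-- The inverse function theorem, with an inverse which is smooth on its whole domain. -/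
theorem ContDiff.exists_openPartialHomeomorph_contDiffOn_symm {X Y : Type*}
    [NormedAddCommGroup X] [NormedSpace ℝ X] [CompleteSpace X]
    [NormedAddCommGroup Y] [NormedSpace ℝ Y] {f : X → Y} (hf : ContDiff ℝ ∞ f) {a : X}
    (A : X ≃L[ℝ] Y) (hA : HasFDerivAt f (A : X →L[ℝ] Y) a) :
    ∃ e : OpenPartialHomeomorph X Y, a ∈ e.source ∧ (∀ x, e x = f x) ∧
      ContDiffOn ℝ ∞ e.symm e.target := by
  let e := hf.contDiffAt.toOpenPartialHomeomorph f hA (by simp)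
  -- Invertibility of the derivative is an open condition; on this set the inverse is smooth at
  -- every point, not only at the image of `a`.
  let s : Set X := fderiv ℝ f ⁻¹' range ((↑) : (X ≃L[ℝ] Y) → X →L[ℝ] Y)
  have hs : IsOpen s := ContinuousLinearEquiv.isOpen.preimage (hf.continuous_fderiv (by simp))
  refine ⟨e.restrOpen s hs, ⟨hf.contDiffAt.mem_toOpenPartialHomeomorph_source hA (by simp), ?_⟩,
    fun _ => rfl, fun y hy => ContDiffAt.contDiffWithinAt ?_⟩
  · exact ⟨A, hA.fderiv.symm⟩
  · have hy' := (e.restrOpen s hs).map_target hy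
    obtain ⟨B, hB⟩ := hy'.2
    refine (e.restrOpen s hs).contDiffAt_symm hy (f₀' := B) ?_ hf.contDiffAt
    rw [hB]
    exact (hf.differentiable (by simp) _).hasFDerivAt

/-- A smooth vector field on a Banach space has a smooth local flow. -/
theorem ContDiff.exists_local_flow {H : Type u} [NormedAddCommGroup H] [NormedSpace ℝ H]
    [CompleteSpace H] {f : H → H} (hf : ContDiff ℝ ∞ f) (h₀ : H) :
    ∃ δ > 0, ∃ φ : ℝ → H → H,
      ContDiffOn ℝ ∞ (fun p : ℝ × H => φ p.1 p.2) (Metric.ball 0 δ ×ˢ Metric.ball h₀ δ) ∧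
      ∀ h ∈ Metric.ball h₀ δ, φ 0 h = h ∧
        ∀ t ∈ Metric.ball (0 : ℝ) δ, HasDerivAt (fun t => φ t h) (f (φ t h)) t := by
  let N : C(unitInterval, H) → C(unitInterval, H) := fun γ => (⟨f, hf.continuous⟩ : C(H, H)).comp γ
  have hN : ContDiff ℝ ∞ N := contDiff_infty.2 fun n =>
    (hf.of_le (by exact_mod_cast le_top)).continuousMap_comp
  let S := primitiveCLM H
  let Λ : H →L[ℝ] C(unitInterval, H) := LinearMap.mkContinuous
    { toFun := fun h => ContinuousMap.const _ h, map_add' := fun _ _ => rfl,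
      map_smul' := fun _ _ => rfl } 1 (fun h => by
        rw [one_mul]
        exact (ContinuousMap.norm_le _ (norm_nonneg _)).2 fun _ => le_rfl)
  -- A solution on `[0, t]` with initial value `h`, rescaled to `[0, 1]`, is a curve with `γ = h + t
  -- ∫ f ∘ γ`, that is, a zero of the second component. Keeping the parameters as first component
  -- reduces the implicit function theorem to the inverse function theorem.
  let F : (ℝ × H) × C(unitInterval, H) → (ℝ × H) × C(unitInterval, H) :=
    fun q => (q.1, q.2 - Λ q.1.2 - q.1.1 • S (N q.2))
  have hF : ContDiff ℝ ∞ F := by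
    refine contDiff_fst.prodMk ((contDiff_snd.sub (Λ.contDiff.comp (contDiff_snd.comp contDiff_fst))).sub
      ((contDiff_fst.comp contDiff_fst).smul (S.contDiff.comp (hN.comp contDiff_snd))))
  let c : C(unitInterval, H) := Λ h₀
  -- At `t = 0` the derivative of `S (N γ)` is multiplied by zero, so the derivative of `F` is the
  -- shear `(p, η) ↦ (p, η - T p)`, with inverse `(p, η) ↦ (p, η + T p)`.
  let T : (ℝ × H) →L[ℝ] C(unitInterval, H) :=
    Λ.comp (ContinuousLinearMap.snd ℝ ℝ H) + (ContinuousLinearMap.fst ℝ ℝ H).smulRight (S (N c))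
  let A₁ : ((ℝ × H) × C(unitInterval, H)) →L[ℝ] ((ℝ × H) × C(unitInterval, H)) :=
    (ContinuousLinearMap.fst ℝ _ _).prod
      (ContinuousLinearMap.snd ℝ _ _ - T.comp (ContinuousLinearMap.fst ℝ _ _))
  let A₂ : ((ℝ × H) × C(unitInterval, H)) →L[ℝ] ((ℝ × H) × C(unitInterval, H)) :=
    (ContinuousLinearMap.fst ℝ _ _).prod
      (ContinuousLinearMap.snd ℝ _ _ + T.comp (ContinuousLinearMap.fst ℝ _ _))
  let A := ContinuousLinearEquiv.equivOfInverse A₁ A₂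
    (fun q => by ext1 <;> simp [A₁, A₂]) (fun q => by ext1 <;> simp [A₁, A₂])
  have hA : HasFDerivAt F (A : _ →L[ℝ] _) ((0, h₀), c) := by
    have h1 : HasFDerivAt (fun q : (ℝ × H) × C(unitInterval, H) => q.1.1)
        ((ContinuousLinearMap.fst ℝ ℝ H).comp (ContinuousLinearMap.fst ℝ _ _)) ((0, h₀), c) :=
      (ContinuousLinearMap.hasFDerivAt (ContinuousLinearMap.fst ℝ ℝ H)).comp _ hasFDerivAt_fst
    have h2 : HasFDerivAt (fun q : (ℝ × H) × C(unitInterval, H) => S (N q.2)) _ ((0, h₀), c) :=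
      ((S.contDiff.comp (hN.comp contDiff_snd)).differentiable
        (by simp : (∞ : WithTop ℕ∞) ≠ 0) _).hasFDerivAt
    have h3 := h1.smul h2
    have h4 : HasFDerivAt (fun q : (ℝ × H) × C(unitInterval, H) => Λ q.1.2)
        (Λ.comp ((ContinuousLinearMap.snd ℝ ℝ H).comp (ContinuousLinearMap.fst ℝ _ _)))
        ((0, h₀), c) :=
      Λ.hasFDerivAt.comp _
        ((ContinuousLinearMap.hasFDerivAt (ContinuousLinearMap.snd ℝ ℝ H)).comp _ hasFDerivAt_fst)
    refine (hasFDerivAt_fst.prodMk ((hasFDerivAt_snd.sub h4).sub h3)).congr_fderiv ?_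
    refine ContinuousLinearMap.ext fun q => Prod.ext rfl ?_
    change q.2 - Λ q.1.2 - ((0 : ℝ) • _ + q.1.1 • S (N c)) = q.2 - (Λ q.1.2 + q.1.1 • S (N c))
    rw [zero_smul, zero_add, sub_sub]
  obtain ⟨e, ha, he, hes⟩ := hF.exists_openPartialHomeomorph_contDiffOn_symm A hA
  let u : ℝ × H → C(unitInterval, H) := fun p => (e.symm (p, 0)).2
  have hF0 : F ((0, h₀), c) = ((0, h₀), 0) := by simp [F, c]
  have hu0 : u (0, h₀) = c := by
    have := e.left_inv ha
    rw [he, hF0] at this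
    exact congrArg Prod.snd this
  have ht0 : ((0, h₀), (0 : C(unitInterval, H))) ∈ e.target := by
    have := e.map_source ha
    rwa [he, hF0] at this
  have hW : IsOpen {p : ℝ × H | (p, (0 : C(unitInterval, H))) ∈ e.target} :=
    e.open_target.preimage (by fun_prop)
  have huc : ContDiffOn ℝ ∞ u {p : ℝ × H | (p, (0 : C(unitInterval, H))) ∈ e.target} :=
    contDiff_snd.comp_contDiffOn (hes.comp (contDiff_id.prodMk contDiff_const).contDiffOn
      fun p hp => hp)
  obtain ⟨r, hr, hrs⟩ := Metric.isOpen_iff.1 e.open_source _ ha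
  obtain ⟨δ, hδ, hδW⟩ := Metric.mem_nhds_iff.1 (Filter.inter_mem (hW.mem_nhds ht0)
    ((huc.continuousOn.continuousAt (hW.mem_nhds ht0)).preimage_mem_nhds
      (Metric.ball_mem_nhds _ hr)))
  have hδr : ∀ t ∈ Metric.ball (0 : ℝ) (min δ r), ∀ h ∈ Metric.ball h₀ (min δ r),
      (t, h) ∈ Metric.ball ((0 : ℝ), h₀) δ ∧ (t, h) ∈ Metric.ball ((0 : ℝ), h₀) r := by
    intro t ht h hh
    rw [← ball_prod_same, ← ball_prod_same]
    exact ⟨⟨Metric.ball_subset_ball (min_le_left _ _) ht,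
      Metric.ball_subset_ball (min_le_left _ _) hh⟩,
      ⟨Metric.ball_subset_ball (min_le_right _ _) ht,
      Metric.ball_subset_ball (min_le_right _ _) hh⟩⟩
  have hsol : ∀ p, (p, (0 : C(unitInterval, H))) ∈ e.target →
      u p = Λ p.2 + p.1 • S (N (u p)) := by
    intro p hp
    have h1 : F (e.symm (p, 0)) = (p, 0) := by rw [← he]; exact e.right_inv hp
    have h2 : (e.symm (p, 0)).1 = p := congrArg Prod.fst h1
    have h3 : (e.symm (p, 0)).2 - Λ (e.symm (p, 0)).1.2 -
      (e.symm (p, 0)).1.1 • S (N (e.symm (p, 0)).2) = 0 := congrArg Prod.snd h1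
    rw [h2, sub_sub, sub_eq_zero] at h3
    exact h3
  have huniq : ∀ p ∈ Metric.ball ((0 : ℝ), h₀) r, ∀ γ ∈ Metric.ball c r,
      γ = Λ p.2 + p.1 • S (N γ) → u p = γ := by
    intro p hp γ hγ h
    have h1 : (p, γ) ∈ e.source := hrs (by rw [← ball_prod_same]; exact ⟨hp, hγ⟩)
    have h2 : F (p, γ) = (p, 0) := Prod.ext rfl (by
      change γ - Λ p.2 - p.1 • S (N γ) = 0
      rw [sub_sub, sub_eq_zero]; exact h)
    have h3 := e.left_inv h1
    rw [he, h2] at h3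
    exact congrArg Prod.snd h3
  let φ : ℝ → H → H := fun t h => u (t, h) 1
  -- The initial piece of `u (t, h)` up to `σ`, stretched to `[0, 1]`, solves the equation for time
  -- `σ * t` and is no farther from the constant curve `c`, so uniqueness identifies it with `u (σ *
  -- t, h)`. This turns the equation for `u` into the integral equation for `φ`.
  have hresc : ∀ t ∈ Metric.ball (0 : ℝ) (min δ r), ∀ h ∈ Metric.ball h₀ (min δ r),
      ∀ σ : unitInterval, φ (σ * t) h = u (t, h) σ := by
    intro t ht h hh σ
    have hp := hδr t ht h hh
    have hσt : (σ : ℝ) * t ∈ Metric.ball (0 : ℝ) (min δ r) := by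
      rw [mem_ball_zero_iff] at ht ⊢
      rw [norm_mul, Real.norm_of_nonneg σ.2.1]
      exact (mul_le_of_le_one_left (norm_nonneg t) σ.2.2).trans_lt ht
    let γ : C(unitInterval, H) := (u (t, h)).comp ⟨fun τ => σ * τ, by fun_prop⟩
    have hu := hδW hp.1
    rw [mem_inter_iff, mem_preimage, hu0] at hu
    have hγ : γ ∈ Metric.ball c r := by
      have hu2 := Metric.mem_ball.1 hu.2
      refine Metric.mem_ball.2 (lt_of_le_of_lt ?_ hu2)
      refine (ContinuousMap.dist_le dist_nonneg).2 fun τ => ?_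
      exact ContinuousMap.dist_apply_le_dist (f := u (t, h)) (g := c) (σ * τ)
    have h1 : γ = Λ h + ((σ : ℝ) * t) • S (N γ) := by
      ext τ
      have h2 := congrArg (fun η : C(unitInterval, H) => η (σ * τ)) (hsol (t, h) hu.1)
      have h3 := primitiveCLM_comp_mul (N (u (t, h))) σ τ
      change γ τ = h + ((σ : ℝ) * t) • S (N γ) τ
      change γ τ = h + t • S (N (u (t, h))) (σ * τ) at h2
      rw [h2, mul_comm (σ : ℝ) t, mul_smul]
      exact congrArg (fun x => h + t • x) h3.symm
    have h4 := huniq ((σ : ℝ) * t, h) (hδr _ hσt h hh).2 γ hγ h1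
    have h5 := congrArg (fun η : C(unitInterval, H) => η 1) h4
    refine h5.trans ?_
    change u (t, h) (σ * 1) = _
    rw [mul_one]
  have hφ : ContDiffOn ℝ ∞ (fun p : ℝ × H => φ p.1 p.2)
      (Metric.ball 0 (min δ r) ×ˢ Metric.ball h₀ (min δ r)) := by
    refine (ContinuousMap.evalCLM ℝ (1 : unitInterval)).contDiff.comp_contDiffOn (huc.mono ?_)
    rintro ⟨t, h⟩ ⟨ht, hh⟩
    exact (hδW (hδr t ht h hh).1).1
  have hint : ∀ h ∈ Metric.ball h₀ (min δ r), ∀ t ∈ Metric.ball (0 : ℝ) (min δ r),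
      φ t h = h + ∫ τ in (0 : ℝ)..t, f (φ τ h) := by
    intro h hh t ht
    have h1 := congrArg (fun η : C(unitInterval, H) => η 1)
      (hsol (t, h) (hδW (hδr t ht h hh).1).1)
    change φ t h = h + t • ∫ τ in (0 : ℝ)..1, IccExtend zero_le_one (N (u (t, h))) τ at h1
    rw [h1]
    have h2 := intervalIntegral.smul_integral_comp_mul_right (a := 0) (b := 1)
      (fun τ => f (φ τ h)) t
    rw [zero_mul, one_mul] at h2
    rw [← h2]
    congr 2
    refine intervalIntegral.integral_congr fun τ hτ => ?_
    rw [uIcc_of_le zero_le_one] at hτ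
    simp only [IccExtend_of_mem _ _ hτ]
    exact congrArg f (hresc t ht h hh ⟨τ, hτ⟩).symm
  have hpos : 0 < min δ r := lt_min hδ hr
  refine ⟨min δ r, hpos, φ, hφ, fun h hh => ?_⟩
  have hcont : ContinuousOn (fun τ => f (φ τ h)) (Metric.ball 0 (min δ r)) :=
    hf.continuous.comp_continuousOn
      (hφ.continuousOn.comp (by fun_prop : ContinuousOn (fun τ : ℝ => (τ, h)) _)
        fun τ hτ => ⟨hτ, hh⟩)
  refine ⟨by rw [hint h hh 0 (Metric.mem_ball_self hpos)]; simp, fun t ht => ?_⟩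
  have hn := Metric.isOpen_ball.mem_nhds ht
  have hd : HasDerivAt (fun t => ∫ τ in (0 : ℝ)..t, f (φ τ h)) (f (φ t h)) t := by
    refine intervalIntegral.integral_hasDerivAt_right ?_ ?_ (hcont.continuousAt hn)
    · refine (hcont.mono ?_).intervalIntegrable
      exact (convex_ball (0 : ℝ) _).ordConnected.uIcc_subset (Metric.mem_ball_self hpos) ht
    · exact hcont.stronglyMeasurableAtFilter Metric.isOpen_ball t ht
  refine (hd.const_add h).congr_of_eventuallyEq ?_
  filter_upwards [hn] with τ hτ using hint h hh τ hτ

end LocalFlow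

/-! ### Local evolution of time-dependent fields -/

section LocalEvolution

open Filter Topology

/-- A smooth time-dependent vector field has a smooth local evolution, with values in any given
neighbourhood. -/
theorem ContDiffOn.exists_local_evolution {X : Type u} [NormedAddCommGroup X] [NormedSpace ℝ X]
    [FiniteDimensional ℝ X] {f : ℝ × X → X} {U : Set (ℝ × X)} (hU : IsOpen U)
    (hf : ContDiffOn ℝ ∞ f U) {t₀ : ℝ} {x₀ : X} (h₀ : (t₀, x₀) ∈ U) :
    ∃ δ > 0, ∃ Q : ℝ → ℝ → X → X,
      ContDiffOn ℝ ∞ (fun p : ℝ × ℝ × X => Q p.1 p.2.1 p.2.2)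
        (Metric.ball t₀ δ ×ˢ Metric.ball t₀ δ ×ˢ Metric.ball x₀ δ) ∧
      ∀ s ∈ Metric.ball t₀ δ, ∀ x ∈ Metric.ball x₀ δ, Q s s x = x ∧
        ∀ t ∈ Metric.ball t₀ δ, (t, Q t s x) ∈ U ∧
          HasDerivAt (fun t => Q t s x) (f (t, Q t s x)) t := by
  obtain ⟨R, hR, hRU⟩ := Metric.nhds_basis_closedBall.mem_iff.1 (hU.mem_nhds h₀)
  let b : ContDiffBump (t₀, x₀) := ⟨R / 2, R, half_pos hR, half_lt_self hR⟩
  have hbU : tsupport b ⊆ U := b.tsupport_eq.trans_subset hRU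
  -- Time becomes a coordinate of velocity `1`, which makes the equation autonomous. The bump
  -- function makes the field globally smooth without changing it near `(t₀, x₀)`.
  let F : ℝ × X → ℝ × X := fun p => (1, b p • f p)
  have hF : ContDiff ℝ ∞ F := by
    refine contDiff_const.prodMk (contDiff_iff_contDiffAt.2 fun p => ?_)
    by_cases hp : p ∈ U
    · exact b.contDiff.contDiffAt.smul (hf.contDiffAt (hU.mem_nhds hp))
    · have h1 : p ∉ tsupport b := fun h => hp (hbU h)
      have h2 : b =ᶠ[𝓝 p] 0 := notMem_tsupport_iff_eventuallyEq.1 h1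
      refine (contDiffAt_const (c := (0 : X))).congr_of_eventuallyEq ?_
      filter_upwards [h2] with q hq
      rw [hq, Pi.zero_apply, zero_smul]
  obtain ⟨δ, hδ, φ, hφ, hφd⟩ := hF.exists_local_flow (t₀, x₀)
  have hfst : ∀ h ∈ Metric.ball (t₀, x₀) δ, ∀ t ∈ Metric.ball (0 : ℝ) δ,
      (φ t h).1 = h.1 + t := by
    intro h hh t ht
    have hd : ∀ τ ∈ Metric.ball (0 : ℝ) δ, HasDerivAt (fun τ => (φ τ h).1) 1 τ := fun τ hτ => by
      have := (ContinuousLinearMap.fst ℝ ℝ X).hasFDerivAt.comp_hasDerivAt τ ((hφd h hh).2 τ hτ)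
      exact this
    refine Metric.isOpen_ball.eqOn_of_deriv_eq (f := fun τ => (φ τ h).1) (g := fun τ => h.1 + τ)
      (convex_ball _ _).isPreconnected
      (fun τ hτ => (hd τ hτ).differentiableAt.differentiableWithinAt)
      (by fun_prop) (fun τ hτ => ?_) (Metric.mem_ball_self hδ) ?_ ht
    · rw [(hd τ hτ).deriv, ((hasDerivAt_id' τ).const_add h.1).deriv]
    · simp [(hφd h hh).1]
  let Q : ℝ → ℝ → X → X := fun t s x => (φ (t - s) (s, x)).2
  let W : Set (ℝ × ℝ × X) :=
    Metric.ball t₀ (δ / 2) ×ˢ Metric.ball t₀ (δ / 2) ×ˢ Metric.ball x₀ (δ / 2)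
  have hW : W ∈ 𝓝 (t₀, t₀, x₀) := prod_mem_nhds (Metric.ball_mem_nhds _ (half_pos hδ))
    (prod_mem_nhds (Metric.ball_mem_nhds _ (half_pos hδ)) (Metric.ball_mem_nhds _ (half_pos hδ)))
  have hmaps : ∀ t ∈ Metric.ball t₀ (δ / 2), ∀ s ∈ Metric.ball t₀ (δ / 2),
      ∀ x ∈ Metric.ball x₀ (δ / 2),
        t - s ∈ Metric.ball (0 : ℝ) δ ∧ (s, x) ∈ Metric.ball (t₀, x₀) δ := by
    intro t ht s hs x hx
    refine ⟨?_, ?_⟩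
    · rw [mem_ball_zero_iff, ← dist_eq_norm]
      have := dist_triangle_right t s t₀
      rw [Metric.mem_ball] at ht hs
      linarith
    · rw [← ball_prod_same]
      exact ⟨Metric.ball_subset_ball (by linarith) hs, Metric.ball_subset_ball (by linarith) hx⟩
  have hQ : ContDiffOn ℝ ∞ (fun p : ℝ × ℝ × X => Q p.1 p.2.1 p.2.2) W := by
    refine contDiff_snd.comp_contDiffOn (hφ.comp (t := Metric.ball 0 δ ×ˢ Metric.ball (t₀, x₀) δ)
      (f := fun p : ℝ × ℝ × X => (p.1 - p.2.1, p.2)) (by fun_prop) ?_)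
    rintro ⟨t, s, x⟩ ⟨ht, hs, hx⟩
    exact hmaps t ht s hs x hx
  have hQ0 : Q t₀ t₀ x₀ = x₀ := by
    simp [Q, (hφd _ (Metric.mem_ball_self hδ)).1]
  have hc : Tendsto (fun p : ℝ × ℝ × X => (p.1, Q p.1 p.2.1 p.2.2)) (𝓝 (t₀, t₀, x₀))
      (𝓝 (t₀, x₀)) := by
    have := (continuous_fst.continuousAt (x := (t₀, t₀, x₀))).prodMk
      (hQ.continuousOn.continuousAt hW)
    rwa [ContinuousAt, hQ0] at this
  have hb : ∀ᶠ p in 𝓝 (t₀, x₀), p ∈ U ∧ b p = 1 :=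
    (hU.eventually_mem h₀).and b.eventuallyEq_one
  -- On this smaller ball the trajectories stay where `b = 1`, so they solve the original equation.
  obtain ⟨ε, hε, hεW⟩ := Metric.mem_nhds_iff.1 (Filter.inter_mem hW (hc.eventually hb))
  rw [← ball_prod_same, ← ball_prod_same] at hεW
  refine ⟨ε, hε, Q, hQ.mono fun p hp => (hεW hp).1, fun s hs x hx => ⟨?_, fun t ht => ?_⟩⟩
  · obtain ⟨⟨-, hs', hx'⟩, -⟩ := @hεW (s, s, x) ⟨hs, hs, hx⟩
    simp [Q, (hφd _ (hmaps s hs' s hs' x hx').2).1]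
  · obtain ⟨⟨ht', hs', hx'⟩, h1, h2⟩ := @hεW (t, s, x) ⟨ht, hs, hx⟩
    obtain ⟨hts, hsx⟩ := hmaps t ht' s hs' x hx'
    refine ⟨h1, ?_⟩
    have hd := (hφd _ hsx).2 _ hts
    have hd' : HasDerivAt (fun t => Q t s x) (F (φ (t - s) (s, x))).2 t := by
      have := (ContinuousLinearMap.snd ℝ ℝ X).hasFDerivAt.comp_hasDerivAt t (hd.comp_sub_const t s)
      exact this
    have e : φ (t - s) (s, x) = (t, Q t s x) :=
      Prod.ext (by rw [hfst _ hsx _ hts]; simp) rfl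
    rw [e] at hd'
    simpa [F, h2] using hd'

end LocalEvolution

/-! ### Integral curves on manifolds and in charts -/

section TimeDependentIntegralCurve

open Filter Topology

/-- The velocity of the image of a curve. -/
theorem HasMFDerivAt.comp_curve {E : Type*} [NormedAddCommGroup E] [NormedSpace ℝ E]
    {H : Type*} [TopologicalSpace H] {I : ModelWithCorners ℝ E H}
    {F : Type*} [NormedAddCommGroup F] [NormedSpace ℝ F]
    {K : Type*} [TopologicalSpace K] {I' : ModelWithCorners ℝ F K}
    {X : Type*} [TopologicalSpace X] [ChartedSpace H X]
    {Y : Type*} [TopologicalSpace Y] [ChartedSpace K Y]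
    {γ : ℝ → X} {t : ℝ} {v : E} {f : X → Y} {L : E →L[ℝ] F}
    (hγ : HasMFDerivAt 𝓘(ℝ, ℝ) I γ t (ContinuousLinearMap.toSpanSingleton ℝ v))
    (hf : HasMFDerivAt I I' f (γ t) L) :
    HasMFDerivAt 𝓘(ℝ, ℝ) I' (fun t => f (γ t)) t (ContinuousLinearMap.toSpanSingleton ℝ (L v)) :=
  (hf.comp t hγ).congr_mfderiv (ContinuousLinearMap.comp_toSpanSingleton L v)

variable {E : Type u} [NormedAddCommGroup E] [NormedSpace ℝ E]
  {G : Type w₁} [TopologicalSpace G] [ChartedSpace E G]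

/-- `γ` solves `γ' t = Z t (γ t)` for `t ∈ I`. -/
def IsSolutionOn (Z : ℝ → (g : G) → TangentSpace 𝓘(ℝ, E) g) (γ : ℝ → G) (I : Set ℝ) : Prop :=
  ∀ t ∈ I, HasMFDerivAt 𝓘(ℝ, ℝ) 𝓘(ℝ, E) γ t
    (ContinuousLinearMap.toSpanSingleton ℝ (Z t (γ t) : E))

/-- The expression of a time-dependent vector field in the preferred chart at `x`. -/
def chartField (Z : ℝ → (g : G) → TangentSpace 𝓘(ℝ, E) g) (x : G) (p : ℝ × E) : E :=
  mfderiv 𝓘(ℝ, E) 𝓘(ℝ, E) (extChartAt 𝓘(ℝ, E) x) ((extChartAt 𝓘(ℝ, E) x).symm p.2)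
    (Z p.1 ((extChartAt 𝓘(ℝ, E) x).symm p.2))

theorem IsSolutionOn.mono {Z : ℝ → (g : G) → TangentSpace 𝓘(ℝ, E) g} {γ : ℝ → G} {I I' : Set ℝ}
    (h : IsSolutionOn Z γ I) (hI : I' ⊆ I) : IsSolutionOn Z γ I' := fun t ht => h t (hI ht)

variable [IsManifold 𝓘(ℝ, E) ∞ G]

/-- Over a chart domain, the fibre coordinate of the tangent bundle is the derivative of the chart;
hence this is smoothness into `TG` read in a trivialization. -/
theorem IsSmoothVectorFieldFamily.contDiffOn_chartField {J : Set ℝ}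
    {Z : ℝ → (g : G) → TangentSpace 𝓘(ℝ, E) g} (hZ : IsSmoothVectorFieldFamily J Z) (x : G) :
    ContDiffOn ℝ ∞ (chartField Z x) (J ×ˢ (extChartAt 𝓘(ℝ, E) x).target) := by
  have : IsManifold 𝓘(ℝ, E) 1 G := .of_le (n := ∞) (by simp)
  let e := trivializationAt E (TangentSpace 𝓘(ℝ, E)) x
  have h1 : ContMDiffOn 𝓘(ℝ, ℝ × E) (𝓘(ℝ, ℝ).prod 𝓘(ℝ, E)) ∞
      (fun p : ℝ × E => (p.1, (extChartAt 𝓘(ℝ, E) x).symm p.2))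
      (J ×ˢ (extChartAt 𝓘(ℝ, E) x).target) :=
    contDiff_fst.contMDiff.contMDiffOn.prodMk ((contMDiffOn_extChartAt_symm x).comp
      contDiff_snd.contMDiff.contMDiffOn fun p hp => hp.2)
  have h2 := hZ.comp h1 fun p hp => ⟨hp.1, mem_univ _⟩
  have hsrc : ∀ p ∈ J ×ˢ (extChartAt 𝓘(ℝ, E) x).target,
      (extChartAt 𝓘(ℝ, E) x).symm p.2 ∈ (chartAt E x).source := fun p hp => by
    rw [← extChartAt_source 𝓘(ℝ, E) x]
    exact (extChartAt 𝓘(ℝ, E) x).map_target hp.2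
  have h3 := contMDiff_snd.comp_contMDiffOn ((Bundle.Trivialization.contMDiffOn (n := ∞) (IB := 𝓘(ℝ, E)) e).comp h2
    fun p hp => e.mem_source.2 (hsrc p hp))
  refine (contMDiffOn_iff_contDiffOn.1 h3).congr fun p hp => ?_
  have h4 := TangentBundle.continuousLinearMapAt_trivializationAt (𝕜 := ℝ) (I := 𝓘(ℝ, E)) (hsrc p hp)
  have h5 := congrArg (fun L : E →L[ℝ] E => L (Z p.1 ((extChartAt 𝓘(ℝ, E) x).symm p.2))) h4
  refine h5.symm.trans ?_
  exact congrFun (e.coe_linearMapAt_of_mem (R := ℝ) (hsrc p hp)) _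

/-- Solutions in the manifold are solutions in a chart. -/
theorem hasDerivAt_extChartAt_comp {γ : ℝ → G} {t : ℝ} {v : E} {x : G}
    (h : HasMFDerivAt 𝓘(ℝ, ℝ) 𝓘(ℝ, E) γ t (ContinuousLinearMap.toSpanSingleton ℝ v))
    (hx : γ t ∈ (extChartAt 𝓘(ℝ, E) x).source) :
    HasDerivAt (extChartAt 𝓘(ℝ, E) x ∘ γ)
      (mfderiv 𝓘(ℝ, E) 𝓘(ℝ, E) (extChartAt 𝓘(ℝ, E) x) (γ t) v) t := by
  have : IsManifold 𝓘(ℝ, E) 1 G := .of_le (n := ∞) (by simp)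
  rw [extChartAt_source] at hx
  exact hasMFDerivAt_iff_hasFDerivAt.1
    (h.comp_curve (mdifferentiableAt_extChartAt (I := 𝓘(ℝ, E)) hx).hasMFDerivAt)

/-- Solutions in a chart are solutions in the manifold. -/
theorem hasMFDerivAt_extChartAt_symm_comp {y : ℝ → E} {t : ℝ} {x : G}
    (hx : y t ∈ (extChartAt 𝓘(ℝ, E) x).target) {v : E}
    (h : HasDerivAt y (mfderiv 𝓘(ℝ, E) 𝓘(ℝ, E) (extChartAt 𝓘(ℝ, E) x)
      ((extChartAt 𝓘(ℝ, E) x).symm (y t)) v) t) :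
    HasMFDerivAt 𝓘(ℝ, ℝ) 𝓘(ℝ, E) (fun t => (extChartAt 𝓘(ℝ, E) x).symm (y t)) t
      (ContinuousLinearMap.toSpanSingleton ℝ v) := by
  have : IsManifold 𝓘(ℝ, E) 1 G := .of_le (n := ∞) (by simp)
  have h1 := mfderivWithin_extChartAt_symm_comp_mfderiv_extChartAt (I := 𝓘(ℝ, E)) hx
  have h2 := (mdifferentiableWithinAt_extChartAt_symm (I := 𝓘(ℝ, E)) hx).hasMFDerivWithinAt
  rw [modelWithCornersSelf_coe, range_id] at h1 h2
  have h3 := HasMFDerivAt.comp_curve (hasMFDerivAt_iff_hasFDerivAt.2 h.hasFDerivAt)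
    (hasMFDerivWithinAt_univ.1 h2)
  have h4 := congrArg (fun L : E →L[ℝ] E => L v) h1
  exact h3.congr_mfderiv (congrArg (ContinuousLinearMap.toSpanSingleton ℝ) h4)

end TimeDependentIntegralCurve

/-! ### Uniqueness and global evolution on a compact manifold -/

section Evolution

open Filter Topology

variable {E : Type u} [NormedAddCommGroup E] [NormedSpace ℝ E]
  {G : Type w₁} [TopologicalSpace G] [ChartedSpace E G]
  {J : Set ℝ} {Z : ℝ → (g : G) → TangentSpace 𝓘(ℝ, E) g}

/-- Near `x`, and over the interval of radius `δ` around `t₀`, the solutions of the differential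
equation given by `Z` form a smooth family. -/
def HasLocalEvolution (Z : ℝ → (g : G) → TangentSpace 𝓘(ℝ, E) g) (t₀ δ : ℝ) (x : G) : Prop :=
  ∃ U ∈ 𝓝 x, ∃ Q : ℝ → ℝ → G → G,
    ContMDiffOn (𝓘(ℝ, ℝ).prod (𝓘(ℝ, ℝ).prod 𝓘(ℝ, E))) 𝓘(ℝ, E) ∞
      (fun p : ℝ × ℝ × G => Q p.1 p.2.1 p.2.2) (Metric.ball t₀ δ ×ˢ Metric.ball t₀ δ ×ˢ U) ∧
    ∀ s ∈ Metric.ball t₀ δ, ∀ y ∈ U, Q s s y = y ∧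
      IsSolutionOn Z (fun t => Q t s y) (Metric.ball t₀ δ)

theorem HasLocalEvolution.mono {t₀ δ δ' : ℝ} {x : G} (h : HasLocalEvolution Z t₀ δ x)
    (hδ : δ' ≤ δ) : HasLocalEvolution Z t₀ δ' x := by
  obtain ⟨U, hU, Q, hQ, hQ'⟩ := h
  have hb := Metric.ball_subset_ball (x := t₀) hδ
  exact ⟨U, hU, Q, hQ.mono (prod_mono hb (prod_mono hb le_rfl)), fun s hs y hy =>
    ⟨(hQ' s (hb hs) y hy).1, (hQ' s (hb hs) y hy).2.mono hb⟩⟩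

variable [IsManifold 𝓘(ℝ, E) ∞ G]

/-- In a chart the field is `C¹`, hence locally Lipschitz, and ODE uniqueness applies. Only germs
are compared, since the curves may leave the chart. -/
theorem IsSolutionOn.eventuallyEq (hJ : IsOpen J) (hZ : IsSmoothVectorFieldFamily J Z) {t : ℝ}
    (ht : t ∈ J) {I : Set ℝ} (hI : I ∈ 𝓝 t) {γ₁ γ₂ : ℝ → G} (h₁ : IsSolutionOn Z γ₁ I)
    (h₂ : IsSolutionOn Z γ₂ I) (h : γ₁ t = γ₂ t) : γ₁ =ᶠ[𝓝 t] γ₂ := by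
  let φ := extChartAt 𝓘(ℝ, E) (γ₁ t)
  have hφ : IsOpen φ.source := isOpen_extChartAt_source _
  have hφt : IsOpen φ.target := isOpen_extChartAt_target _
  have hmem : γ₁ t ∈ φ.source := mem_extChartAt_source _
  have hcd : ContDiffAt ℝ 1 (chartField Z (γ₁ t)) (t, φ (γ₁ t)) :=
    ((hZ.contDiffOn_chartField (γ₁ t)).contDiffAt ((hJ.prod hφt).mem_nhds
      ⟨ht, φ.map_source hmem⟩)).of_le (by simp)
  obtain ⟨K, s, hs, hK⟩ := hcd.exists_lipschitzOnWith
  have hsol : ∀ γ : ℝ → G, IsSolutionOn Z γ I → γ t = γ₁ t → ∀ᶠ τ in 𝓝 t,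
      γ τ ∈ φ.source ∧ HasDerivAt (φ ∘ γ) (chartField Z (γ₁ t) (τ, (φ ∘ γ) τ)) τ ∧
        (φ ∘ γ) τ ∈ {y | (τ, y) ∈ s} := by
    intro γ hγ hγt
    have hc : ContinuousAt γ t := (hγ t (mem_of_mem_nhds hI)).continuousAt
    have hsrc : ∀ᶠ τ in 𝓝 t, γ τ ∈ φ.source :=
      hc.eventually_mem (hφ.mem_nhds (by rw [hγt]; exact hmem))
    have hc' : ContinuousAt (fun τ => (τ, φ (γ τ))) t := by
      refine continuousAt_id.prodMk (ContinuousAt.comp ?_ hc)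
      exact continuousAt_extChartAt' (by rw [hγt]; exact hmem)
    have hs' : ∀ᶠ τ in 𝓝 t, (τ, φ (γ τ)) ∈ s := hc'.eventually_mem (by rw [hγt]; exact hs)
    filter_upwards [hsrc, hs', hI] with τ h1 h2 h3
    refine ⟨h1, ?_, h2⟩
    have := hasDerivAt_extChartAt_comp (hγ τ h3) h1
    have e : chartField Z (γ₁ t) (τ, (φ ∘ γ) τ) = mfderiv 𝓘(ℝ, E) 𝓘(ℝ, E) φ (γ τ) (Z τ (γ τ)) := by
      change mfderiv 𝓘(ℝ, E) 𝓘(ℝ, E) φ (φ.symm (φ (γ τ))) (Z τ (φ.symm (φ (γ τ)))) = _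
      rw [φ.left_inv h1]
    rw [e]
    exact this
  have hl : ∀ᶠ τ in 𝓝 t, LipschitzOnWith K (fun y => chartField Z (γ₁ t) (τ, y))
      {y | (τ, y) ∈ s} := .of_forall fun τ x hx y hy => by
    refine (hK hx hy).trans_eq ?_
    simp [Prod.edist_eq]
  have h1 := hsol γ₁ h₁ rfl
  have h2 := hsol γ₂ h₂ h.symm
  have := ODE_solution_unique_of_eventually (v := fun τ y => chartField Z (γ₁ t) (τ, y)) hl
    (h1.mono fun _ h => h.2) (h2.mono fun _ h => h.2) (congrArg φ h)
  filter_upwards [this, h1, h2] with τ h3 h4 h5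
  exact φ.injOn h4.1 h5.1 h3

/-- Uniqueness of solutions. -/
theorem IsSolutionOn.eqOn [T2Space G] (hJ : IsOpen J) (hZ : IsSmoothVectorFieldFamily J Z)
    {I : Set ℝ} (hI : IsOpen I) (hI' : I.OrdConnected) (hIJ : I ⊆ J) {γ₁ γ₂ : ℝ → G}
    (h₁ : IsSolutionOn Z γ₁ I) (h₂ : IsSolutionOn Z γ₂ I) {t : ℝ} (ht : t ∈ I)
    (h : γ₁ t = γ₂ t) : EqOn γ₁ γ₂ I := by
  have hloc : ∀ t ∈ I, γ₁ t = γ₂ t → γ₁ =ᶠ[𝓝 t] γ₂ := fun t ht h =>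
    h₁.eventuallyEq hJ hZ (hIJ ht) (hI.mem_nhds ht) h₂ h
  -- The set of times with equal germs is open. It is closed in `I`: at a limit time the values
  -- agree because the space is Hausdorff, and local uniqueness upgrades this to germs.
  have := hI'.isPreconnected.subset_of_closure_inter_subset
    (u := {t | γ₁ =ᶠ[𝓝 t] γ₂}) isOpen_setOfPred_eventually_nhds ⟨t, ht, hloc t ht h⟩ ?_
  · exact fun t ht => (this ht).eq_of_nhds
  · rintro τ ⟨hτ, hτI⟩
    refine hloc τ hτI ?_
    have hf : ∃ᶠ σ in 𝓝 τ, γ₁ σ = γ₂ σ :=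
      (mem_closure_iff_frequently.1 hτ).mono fun σ hσ => EventuallyEq.eq_of_nhds hσ
    by_contra hne
    have hev := ((h₁ τ hτI).continuousAt.prodMk (h₂ τ hτI).continuousAt).eventually_mem
      ((isClosed_diagonal (X := G)).isOpen_compl.mem_nhds (by simpa using hne))
    exact hf (hev.mono fun σ hσ => by simpa using hσ)

/-- Transport of the local evolution from a chart. One `δ` serves a whole neighbourhood of `x`, as
the compactness argument requires. -/
theorem IsSmoothVectorFieldFamily.exists_hasLocalEvolution [FiniteDimensional ℝ E]
    (hJ : IsOpen J) (hZ : IsSmoothVectorFieldFamily J Z) {t₀ : ℝ} (ht₀ : t₀ ∈ J) (x : G) :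
    ∃ δ > 0, ∃ U ∈ 𝓝 x, Metric.ball t₀ δ ⊆ J ∧ ∀ y ∈ U, HasLocalEvolution Z t₀ δ y := by
  let φ := extChartAt 𝓘(ℝ, E) x
  have hφ : IsOpen φ.source := isOpen_extChartAt_source _
  have hφt : IsOpen φ.target := isOpen_extChartAt_target _
  obtain ⟨δ, hδ, Q, hQ, hQ'⟩ := (hZ.contDiffOn_chartField x).exists_local_evolution
    (hJ.prod hφt) (t₀ := t₀) (x₀ := φ x) ⟨ht₀, mem_extChartAt_target _⟩
  let U : Set G := φ.source ∩ φ ⁻¹' Metric.ball (φ x) δ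
  have hUo : IsOpen U := (continuousOn_extChartAt x).isOpen_inter_preimage hφ Metric.isOpen_ball
  have hxU : x ∈ U := ⟨mem_extChartAt_source _, Metric.mem_ball_self hδ⟩
  refine ⟨δ, hδ, U, hUo.mem_nhds hxU, fun t ht => ?_, fun y hy => ⟨U, hUo.mem_nhds hy,
    fun t s y => φ.symm (Q t s (φ y)), ?_, fun s hs y hy => ⟨?_, fun t ht => ?_⟩⟩⟩
  · exact ((hQ' t ht (φ x) hxU.2).2 t ht).1.1
  · have h1 : ContMDiffOn (𝓘(ℝ, ℝ).prod (𝓘(ℝ, ℝ).prod 𝓘(ℝ, E)))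
        𝓘(ℝ, ℝ × ℝ × E) ∞ (fun p : ℝ × ℝ × G => (p.1, p.2.1, φ p.2.2))
        (Metric.ball t₀ δ ×ˢ Metric.ball t₀ δ ×ˢ U) := by
      refine contMDiff_fst.contMDiffOn.prodMk_space
        ((contMDiff_fst.comp contMDiff_snd).contMDiffOn.prodMk_space ?_)
      exact contMDiffOn_extChartAt.comp (contMDiff_snd.comp contMDiff_snd).contMDiffOn
        fun p hp => by simpa [φ] using hp.2.2.1
    have h2 := hQ.contMDiffOn.comp h1 fun p hp => ⟨hp.1, hp.2.1, hp.2.2.2⟩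
    exact (contMDiffOn_extChartAt_symm x).comp h2 fun p hp =>
      ((hQ' p.2.1 hp.2.1 _ hp.2.2.2).2 p.1 hp.1).1.2
  · change φ.symm (Q s s (φ y)) = y
    rw [(hQ' s hs _ hy.2).1, φ.left_inv hy.1]
  · obtain ⟨⟨-, h1⟩, h2⟩ := (hQ' s hs _ hy.2).2 t ht
    exact hasMFDerivAt_extChartAt_symm_comp (y := fun t => Q t s (φ y)) h1 h2

/-- Compactness of `G` gives a lifetime independent of the initial point, so no solution can stop
inside `J`. -/
theorem IsSmoothVectorFieldFamily.exists_forall_hasLocalEvolution [FiniteDimensional ℝ E]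
    [CompactSpace G] (hJ : IsOpen J) (hZ : IsSmoothVectorFieldFamily J Z) {t₀ : ℝ} (ht₀ : t₀ ∈ J) :
    ∃ δ > 0, Metric.ball t₀ δ ⊆ J ∧ ∀ x : G, HasLocalEvolution Z t₀ δ x := by
  have := isCompact_univ.induction_on (X := G)
    (p := fun S => ∃ δ > 0, Metric.ball t₀ δ ⊆ J ∧ ∀ x ∈ S, HasLocalEvolution Z t₀ δ x)
    ?_ (fun S T hST hT => ?_) (fun S T hS hT => ?_) (fun x _ => ?_)
  · simpa using this
  · obtain ⟨δ, hδ, h⟩ := Metric.isOpen_iff.1 hJ t₀ ht₀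
    exact ⟨δ, hδ, h, by simp⟩
  · obtain ⟨δ, hδ, hb, h⟩ := hT
    exact ⟨δ, hδ, hb, fun x hx => h x (hST hx)⟩
  · obtain ⟨δ, hδ, hb, h⟩ := hS
    obtain ⟨δ', hδ', -, h'⟩ := hT
    refine ⟨min δ δ', lt_min hδ hδ', (Metric.ball_subset_ball (min_le_left _ _)).trans hb, ?_⟩
    rintro x (hx | hx)
    · exact (h x hx).mono (min_le_left _ _)
    · exact (h' x hx).mono (min_le_right _ _)
  · obtain ⟨δ, hδ, U, hU, hb, h⟩ := hZ.exists_hasLocalEvolution hJ ht₀ x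
    exact ⟨U, mem_nhdsWithin_of_mem_nhds hU, δ, hδ, hb, h⟩

/-- Two solutions that agree at a common time can be glued. -/
theorem IsSolutionOn.exists_union [T2Space G] (hJ : IsOpen J) (hZ : IsSmoothVectorFieldFamily J Z)
    {I₁ I₂ : Set ℝ} (ho₁ : IsOpen I₁) (ho₂ : IsOpen I₂) (hc₁ : I₁.OrdConnected)
    (hc₂ : I₂.OrdConnected) (hI₁ : I₁ ⊆ J) {γ₁ γ₂ : ℝ → G} (h₁ : IsSolutionOn Z γ₁ I₁)
    (h₂ : IsSolutionOn Z γ₂ I₂) {t : ℝ} (ht₁ : t ∈ I₁) (ht₂ : t ∈ I₂) (h : γ₁ t = γ₂ t) :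
    ∃ γ : ℝ → G, EqOn γ γ₁ I₁ ∧ EqOn γ γ₂ I₂ ∧ IsSolutionOn Z γ (I₁ ∪ I₂) := by
  classical
  have he : EqOn γ₁ γ₂ (I₁ ∩ I₂) := (h₁.mono inter_subset_left).eqOn hJ hZ (ho₁.inter ho₂)
    (hc₁.inter hc₂) (inter_subset_left.trans hI₁) (h₂.mono inter_subset_right) ⟨ht₁, ht₂⟩ h
  have e₁ : EqOn (I₁.piecewise γ₁ γ₂) γ₁ I₁ := piecewise_eqOn _ _ _
  have e₂ : EqOn (I₁.piecewise γ₁ γ₂) γ₂ I₂ := fun s hs => by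
    by_cases h : s ∈ I₁
    · rw [piecewise_eq_of_mem _ _ _ h]
      exact he ⟨h, hs⟩
    · rw [piecewise_eq_of_notMem _ _ _ h]
  have congr : ∀ {I : Set ℝ} {γ γ' : ℝ → G}, IsOpen I → IsSolutionOn Z γ' I → EqOn γ γ' I →
      IsSolutionOn Z γ I := fun {I γ γ'} ho hs he s hs' => by
    rw [he hs']
    exact (hs s hs').congr_of_eventuallyEq (he.eventuallyEq_of_mem (ho.mem_nhds hs'))
  refine ⟨_, e₁, e₂, fun s hs => ?_⟩
  rcases hs with hs | hs
  · exact congr ho₁ h₁ e₁ s hs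
  · exact congr ho₂ h₂ e₂ s hs

/-- The solutions of a smooth time-dependent differential equation on a compact manifold are
defined for all times, and form a smooth family. -/
theorem IsSmoothVectorFieldFamily.exists_evolution [FiniteDimensional ℝ E] [CompactSpace G]
    [T2Space G] (hJ : IsOpen J) (hJ' : J.OrdConnected) (hZ : IsSmoothVectorFieldFamily J Z) :
    ∃ P : ℝ → ℝ → G → G,
      ContMDiffOn (𝓘(ℝ, ℝ).prod (𝓘(ℝ, ℝ).prod 𝓘(ℝ, E))) 𝓘(ℝ, E) ∞
        (fun p : ℝ × ℝ × G => P p.1 p.2.1 p.2.2) (J ×ˢ J ×ˢ univ) ∧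
      (∀ s ∈ J, ∀ x, P s s x = x) ∧ (∀ s ∈ J, ∀ x, IsSolutionOn Z (fun t => P t s x) J) ∧
      ∀ r ∈ J, ∀ s ∈ J, ∀ t ∈ J, ∀ x, P t r (P r s x) = P t s x := by
  have hex : ∀ s ∈ J, ∀ t ∈ J, ∀ x : G, ∃ I ⊆ J, IsOpen I ∧ I.OrdConnected ∧ s ∈ I ∧ t ∈ I ∧
      ∃ γ : ℝ → G, γ s = x ∧ IsSolutionOn Z γ I := by
    intro s hs t ht
    -- The relation "solutions starting at time `s` reach time `t`" is transitive by gluing and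
    -- holds near the diagonal by the uniform lifetime; on a connected `J` it therefore always
    -- holds.
    refine hJ'.isPreconnected.induction₂' (fun s t => ∀ x : G, ∃ I ⊆ J, IsOpen I ∧
      I.OrdConnected ∧ s ∈ I ∧ t ∈ I ∧ ∃ γ : ℝ → G, γ s = x ∧ IsSolutionOn Z γ I) ?_ ?_ hs ht
    · intro s hs
      obtain ⟨δ, hδ, hb, h⟩ := hZ.exists_forall_hasLocalEvolution hJ hs
      refine mem_nhdsWithin_of_mem_nhds ?_
      filter_upwards [Metric.ball_mem_nhds s hδ] with t ht
      have key : ∀ r ∈ Metric.ball s δ, ∀ r' ∈ Metric.ball s δ, ∀ x : G, ∃ I ⊆ J, IsOpen I ∧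
          I.OrdConnected ∧ r ∈ I ∧ r' ∈ I ∧ ∃ γ : ℝ → G, γ r = x ∧ IsSolutionOn Z γ I := by
        intro r hr r' hr' x
        obtain ⟨U, hU, Q, -, hQ⟩ := h x
        have := hQ r hr x (mem_of_mem_nhds hU)
        exact ⟨_, hb, Metric.isOpen_ball, (convex_ball _ _).ordConnected, hr, hr', fun t => Q t r x, this⟩
      exact ⟨key s (Metric.mem_ball_self hδ) t ht, key t ht s (Metric.mem_ball_self hδ)⟩
    · intro r s t hr hs ht h1 h2 x
      obtain ⟨I₁, hI₁, ho₁, hc₁, hr₁, hs₁, γ₁, hx₁, hγ₁⟩ := h1 x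
      obtain ⟨I₂, hI₂, ho₂, hc₂, hs₂, ht₂, γ₂, hx₂, hγ₂⟩ := h2 (γ₁ s)
      obtain ⟨γ, e₁, -, hγ⟩ := hγ₁.exists_union hJ hZ ho₁ ho₂ hc₁ hc₂ hI₁ hγ₂ hs₁ hs₂ hx₂.symm
      exact ⟨I₁ ∪ I₂, union_subset hI₁ hI₂, ho₁.union ho₂,
        (hc₁.isPreconnected.union s hs₁ hs₂ hc₂.isPreconnected).ordConnected, .inl hr₁, .inr ht₂,
        γ, (e₁ hr₁).trans hx₁, hγ⟩
  choose! I hI ho hc hs ht γ hγ hsol using hex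
  let P : ℝ → ℝ → G → G := fun t s x => γ s t x t
  -- The chosen curve `γ s t x` also depends on the final time `t`. By uniqueness `P` nevertheless
  -- agrees with every solution, which gives both the equation and the composition law.
  have hP : ∀ (I' : Set ℝ) (η : ℝ → G), I' ⊆ J → IsOpen I' → I'.OrdConnected →
      IsSolutionOn Z η I' → ∀ s ∈ I', ∀ t ∈ I', P t s (η s) = η t := by
    intro I' η hI' ho' hc' hη s hs' t ht'
    have hsJ := hI' hs'
    have htJ := hI' ht'
    refine ((hsol s hsJ t htJ (η s)).mono inter_subset_left).eqOn hJ hZ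
      ((ho s hsJ t htJ (η s)).inter ho') ((hc s hsJ t htJ (η s)).inter hc')
      (inter_subset_right.trans hI') (hη.mono inter_subset_right)
      (t := s) ⟨hs s hsJ t htJ _, hs'⟩ (hγ s hsJ t htJ _) ⟨ht s hsJ t htJ _, ht'⟩
  have hPsol : ∀ s ∈ J, ∀ x, IsSolutionOn Z (fun t => P t s x) J := by
    intro s hsJ x t htJ
    have hev : (fun τ => P τ s x) =ᶠ[𝓝 t] γ s t x := by
      filter_upwards [(ho s hsJ t htJ x).mem_nhds (ht s hsJ t htJ x)] with τ hτ
      have := hP _ _ (hI s hsJ t htJ x) (ho s hsJ t htJ x) (hc s hsJ t htJ x)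
        (hsol s hsJ t htJ x) s (hs s hsJ t htJ x) τ hτ
      rwa [hγ s hsJ t htJ x] at this
    exact (hsol s hsJ t htJ x t (ht s hsJ t htJ x)).congr_of_eventuallyEq hev
  have hPcomp : ∀ r ∈ J, ∀ s ∈ J, ∀ t ∈ J, ∀ x, P t r (P r s x) = P t s x :=
    fun r hr s hs t ht x => hP J (fun t => P t s x) le_rfl hJ hJ' (hPsol s hs x) r hr t ht
  refine ⟨P, ?_, fun s hsJ x => hγ s hsJ s hsJ x, hPsol, hPcomp⟩
  rintro ⟨t, s, x⟩ ⟨(htJ : t ∈ J), (hsJ : s ∈ J), -⟩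
  refine ContMDiffAt.contMDiffWithinAt ?_
  revert x
  -- The same connectedness principle, applied to smoothness of `P` at `(t, s, x)` for every `x`:
  -- near the diagonal `P` is a local evolution, and transitivity comes from `P t s = P t r ∘ P r
  -- s`.
  refine hJ'.isPreconnected.induction₂' (fun s t => ∀ x,
    ContMDiffAt (𝓘(ℝ, ℝ).prod (𝓘(ℝ, ℝ).prod 𝓘(ℝ, E))) 𝓘(ℝ, E) ∞
      (fun p : ℝ × ℝ × G => P p.1 p.2.1 p.2.2) (t, s, x)) ?_ ?_ hsJ htJ
  · intro s hs
    obtain ⟨δ, hδ, hb, h⟩ := hZ.exists_forall_hasLocalEvolution hJ hs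
    have key : ∀ r ∈ Metric.ball s δ, ∀ r' ∈ Metric.ball s δ, ∀ x,
        ContMDiffAt (𝓘(ℝ, ℝ).prod (𝓘(ℝ, ℝ).prod 𝓘(ℝ, E))) 𝓘(ℝ, E) ∞
          (fun p : ℝ × ℝ × G => P p.1 p.2.1 p.2.2) (r', r, x) := by
      intro r hr r' hr' x
      obtain ⟨U, hU, Q, hQ, hQ'⟩ := h x
      have hn : Metric.ball s δ ×ˢ Metric.ball s δ ×ˢ U ∈ 𝓝 (r', r, x) :=
        prod_mem_nhds (Metric.isOpen_ball.mem_nhds hr')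
          (prod_mem_nhds (Metric.isOpen_ball.mem_nhds hr) hU)
      refine (hQ.contMDiffAt hn).congr_of_eventuallyEq ?_
      filter_upwards [hn] with ⟨t', s', x'⟩ ⟨ht', hs', hx'⟩
      have := hP _ _ hb Metric.isOpen_ball (convex_ball _ _).ordConnected (hQ' s' hs' x' hx').2
        s' hs' t' ht'
      simp only [(hQ' s' hs' x' hx').1] at this
      exact this
    refine mem_nhdsWithin_of_mem_nhds ?_
    filter_upwards [Metric.ball_mem_nhds s hδ] with t ht
    exact ⟨key s (Metric.mem_ball_self hδ) t ht, key t ht s (Metric.mem_ball_self hδ)⟩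
  · intro s r t hs hr ht h1 h2 x
    have h3 : ContMDiffAt (𝓘(ℝ, ℝ).prod (𝓘(ℝ, ℝ).prod 𝓘(ℝ, E)))
        (𝓘(ℝ, ℝ).prod (𝓘(ℝ, ℝ).prod 𝓘(ℝ, E))) ∞
        (fun p : ℝ × ℝ × G => (r, p.2)) (t, s, x) := contMDiffAt_const.prodMk contMDiffAt_snd
    have h4 : ContMDiffAt (𝓘(ℝ, ℝ).prod (𝓘(ℝ, ℝ).prod 𝓘(ℝ, E)))
        (𝓘(ℝ, ℝ).prod (𝓘(ℝ, ℝ).prod 𝓘(ℝ, E))) ∞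
        (fun p : ℝ × ℝ × G => (p.1, r, P r p.2.1 p.2.2)) (t, s, x) :=
      contMDiffAt_fst.prodMk (contMDiffAt_const.prodMk ((h1 x).comp (t, s, x) h3))
    refine ((h2 (P r s x)).comp (t, s, x) h4).congr_of_eventuallyEq ?_
    filter_upwards [(hJ.prod (hJ.prod isOpen_univ)).mem_nhds
      (⟨ht, hs, mem_univ x⟩ : (t, s, x) ∈ J ×ˢ J ×ˢ univ)] with ⟨t', s', x'⟩ ⟨ht', hs', _⟩
    exact (hPcomp r hr s' hs' t' ht' x').symm

end Evolution

/-! ### Multiplicative fields evolve by automorphisms -/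

namespace LieGroupoid

open Filter Topology

variable {E : Type u} [NormedAddCommGroup E] [NormedSpace ℝ E]
  {E₀ : Type v} [NormedAddCommGroup E₀] [NormedSpace ℝ E₀]
  {G : Type w₁} [TopologicalSpace G] [ChartedSpace E G]
  {M : Type w₂} [TopologicalSpace M] [ChartedSpace E₀ M]
  (𝒢 : LieGroupoid E E₀ G M)

theorem src_div {a b : G} (h : 𝒢.src a = 𝒢.src b) : 𝒢.src (𝒢.div (a, b)) = 𝒢.tgt b :=
  (𝒢.src_mul _ _ (h.trans (𝒢.tgt_inv b).symm)).trans (𝒢.src_inv b)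

theorem div_mul_cancel {a b : G} (h : 𝒢.src a = 𝒢.src b) : 𝒢.mul (𝒢.div (a, b)) b = a := by
  rw [div, 𝒢.mul_assoc _ _ _ (h.trans (𝒢.tgt_inv b).symm) (𝒢.src_inv b), 𝒢.inv_mul, ← h,
    𝒢.mul_unit]

theorem mul_div_cancel {g h : G} (e : 𝒢.src g = 𝒢.tgt h) : 𝒢.div (𝒢.mul g h, h) = g := by
  rw [div, 𝒢.mul_assoc _ _ _ e (𝒢.tgt_inv h).symm, 𝒢.mul_inv, ← e, 𝒢.mul_unit]

/-- The units inject the objects continuously into `G`. The Hausdorff property is needed for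
uniqueness of solutions on the objects. -/
theorem t2Space_objects [T2Space G] (𝒢 : LieGroupoid E E₀ G M) : T2Space M :=
  .of_injective_continuous (Function.LeftInverse.injective 𝒢.src_unit)
    𝒢.contMDiff_unit.continuous

theorem contMDiffOn_div :
    ContMDiffOn (𝓘(ℝ, E).prod 𝓘(ℝ, E)) 𝓘(ℝ, E) ∞ 𝒢.div 𝒢.divisible :=
  𝒢.contMDiffOn_mul.comp (f := fun p : G × G => (p.1, 𝒢.inv p.2))
    (contMDiff_fst.prodMk (𝒢.contMDiff_inv.comp contMDiff_snd)).contMDiffOn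
    fun p hp => Eq.trans hp (𝒢.tgt_inv p.2).symm

/-- The velocity of a quotient of curves. -/
theorem hasMFDerivAt_div {a b : ℝ → G} {t : ℝ} {v w : E}
    (ha : HasMFDerivAt 𝓘(ℝ, ℝ) 𝓘(ℝ, E) a t (ContinuousLinearMap.toSpanSingleton ℝ v))
    (hb : HasMFDerivAt 𝓘(ℝ, ℝ) 𝓘(ℝ, E) b t (ContinuousLinearMap.toSpanSingleton ℝ w))
    (h : ∀ᶠ τ in 𝓝 t, 𝒢.src (a τ) = 𝒢.src (b τ)) :
    HasMFDerivAt 𝓘(ℝ, ℝ) 𝓘(ℝ, E) (fun τ => 𝒢.div (a τ, b τ)) t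
      (ContinuousLinearMap.toSpanSingleton ℝ
        (mfderivWithin (𝓘(ℝ, E).prod 𝓘(ℝ, E)) 𝓘(ℝ, E) 𝒢.div 𝒢.divisible (a t, b t)
          ((v, w) : E × E) : E)) := by
  have hd := (𝒢.contMDiffOn_div.mdifferentiableOn (by simp) (a t, b t)
    h.self_of_nhds).hasMFDerivWithinAt
  have h1 := (HasMFDerivWithinAt.comp t hd (ha.prodMk hb).hasMFDerivWithinAt
    (show {τ | 𝒢.src (a τ) = 𝒢.src (b τ)} ⊆ (fun τ => (a τ, b τ)) ⁻¹' 𝒢.divisible from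
      fun τ hτ => hτ)).hasMFDerivAt h
  refine h1.congr_mfderiv ?_
  have e : (ContinuousLinearMap.toSpanSingleton ℝ v).prod (ContinuousLinearMap.toSpanSingleton ℝ w)
      = ContinuousLinearMap.toSpanSingleton ℝ ((v, w) : E × E) := by
    ext <;> simp
  exact (congrArg (ContinuousLinearMap.comp (mfderivWithin (𝓘(ℝ, E).prod 𝓘(ℝ, E)) 𝓘(ℝ, E) 𝒢.div
    𝒢.divisible (a t, b t) : E × E →L[ℝ] E)) e).trans (ContinuousLinearMap.comp_toSpanSingleton _ _)

-- The cocycle identity rewritten for an arbitrary pair with common source: such a pair is `(g b,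
-- b)` with `g = a b⁻¹`. In this form it says that quotients of solutions are solutions.
variable {𝒢} in
theorem IsDeformationCocycle.mfderivWithin_div [IsManifold 𝓘(ℝ, E) ∞ G]
    {Z : (g : G) → TangentSpace 𝓘(ℝ, E) g}
    (hZ : 𝒢.IsDeformationCocycle Z) {a b : G} (h : 𝒢.src a = 𝒢.src b) :
    (mfderivWithin (𝓘(ℝ, E).prod 𝓘(ℝ, E)) 𝓘(ℝ, E) 𝒢.div 𝒢.divisible (a, b)
      ((Z a, Z b) : E × E) : E) = Z (𝒢.div (a, b)) := by
  have key : ∀ g a' : G, 𝒢.src g = 𝒢.tgt b → 𝒢.mul g b = a' →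
      (mfderivWithin (𝓘(ℝ, E).prod 𝓘(ℝ, E)) 𝓘(ℝ, E) 𝒢.div 𝒢.divisible (a', b)
        ((Z a', Z b) : E × E) : E) = Z g := by
    rintro g a' e rfl
    exact congrArg (fun p : TangentBundle 𝓘(ℝ, E) G => (p.2 : E)) (hZ.2 g b e)
  exact key _ a (𝒢.src_div h) (𝒢.div_mul_cancel h)

/-- The vector field on the objects induced by a source-projectable vector field. -/
def baseField (Z : (g : G) → TangentSpace 𝓘(ℝ, E) g) (x : M) : TangentSpace 𝓘(ℝ, E₀) x :=
  (mfderiv 𝓘(ℝ, E) 𝓘(ℝ, E₀) 𝒢.src (𝒢.unit x) (Z (𝒢.unit x)) : E₀)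

-- The field provided by projectability carries no smoothness. Evaluation at the units identifies it
-- with `baseField`, which inherits smoothness from `Z`.
variable {𝒢} in
theorem IsSrcProjectable.mfderiv_src {Z : (g : G) → TangentSpace 𝓘(ℝ, E) g}
    (hZ : 𝒢.IsSrcProjectable Z) (g : G) :
    (mfderiv 𝓘(ℝ, E) 𝓘(ℝ, E₀) 𝒢.src g (Z g) : E₀) = 𝒢.baseField Z (𝒢.src g) := by
  obtain ⟨V, hV⟩ := hZ
  refine (hV g).trans ((hV (𝒢.unit (𝒢.src g))).trans ?_).symm
  exact congrArg (fun x => (V x : E₀)) (𝒢.src_unit (𝒢.src g))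

theorem isSmoothVectorFieldFamily_baseField [IsManifold 𝓘(ℝ, E) ∞ G] [IsManifold 𝓘(ℝ, E₀) ∞ M]
    {J : Set ℝ} {Z : ℝ → (g : G) → TangentSpace 𝓘(ℝ, E) g} (hZ : IsSmoothVectorFieldFamily J Z) :
    IsSmoothVectorFieldFamily J fun t => 𝒢.baseField (Z t) := by
  have h1 : ContMDiff (𝓘(ℝ, ℝ).prod 𝓘(ℝ, E₀)) (𝓘(ℝ, ℝ).prod 𝓘(ℝ, E)) ∞
      (fun q : ℝ × M => (q.1, 𝒢.unit q.2)) :=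
    contMDiff_fst.prodMk (𝒢.contMDiff_unit.comp contMDiff_snd)
  have h2 : ContMDiff 𝓘(ℝ, E).tangent 𝓘(ℝ, E₀).tangent ∞
      (tangentMap 𝓘(ℝ, E) 𝓘(ℝ, E₀) 𝒢.src) := 𝒢.contMDiff_src.contMDiff_tangentMap (by simp)
  have hZ' : ContMDiffOn _ _ _ _ _ := hZ
  have h3 := h2.comp_contMDiffOn (hZ'.comp (s := J ×ˢ univ) h1.contMDiffOn
    fun q hq => ⟨hq.1, mem_univ _⟩)
  refine h3.congr fun q _ => ?_
  have : ∀ (x y : M) (v : E₀), x = y → (⟨x, v⟩ : TangentBundle 𝓘(ℝ, E₀) M) = ⟨y, v⟩ := by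
    rintro x _ v rfl
    rfl
  exact this _ _ _ (𝒢.src_unit q.2).symm

/-- A diffeomorphism that preserves the fibres of the source, together with its inverse, and
commutes with the division map, is an automorphism. -/
theorem isAutomorphism_of_div (F : G ≃ₘ^∞⟮𝓘(ℝ, E), 𝓘(ℝ, E)⟯ G)
    (hF : ∀ a b, 𝒢.src a = 𝒢.src b → 𝒢.src (F a) = 𝒢.src (F b))
    (hF' : ∀ a b, 𝒢.src a = 𝒢.src b → 𝒢.src (F.symm a) = 𝒢.src (F.symm b))
    (hdiv : ∀ a b, 𝒢.src a = 𝒢.src b → F (𝒢.div (a, b)) = 𝒢.div (F a, F b)) :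
    𝒢.IsAutomorphism F := by
  have hcomp : ∀ g h, 𝒢.src g = 𝒢.tgt h → 𝒢.src (F g) = 𝒢.tgt (F h) ∧
      F (𝒢.mul g h) = 𝒢.mul (F g) (F h) := by
    intro g h e
    -- Division recovers multiplication: `g` is the quotient of `g h` by `h`, so `F g` is the
    -- quotient of `F (g h)` by `F h`, which makes `F g` composable with `F h` and the product equal
    -- to `F (g h)`.
    have h1 := hdiv (𝒢.mul g h) h (𝒢.src_mul g h e)
    have h2 := hF _ _ (𝒢.src_mul g h e)
    rw [𝒢.mul_div_cancel e] at h1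
    rw [h1]
    exact ⟨𝒢.src_div h2, (𝒢.div_mul_cancel h2).symm⟩
  refine ⟨F, ⟨⟨fun x => 𝒢.src (F (𝒢.unit x)), fun x => 𝒢.src (F.symm (𝒢.unit x)), fun x => ?_,
    fun x => ?_⟩, ?_, ?_⟩, fun _ => rfl, fun g => ?_, fun g => ?_, fun g h e => (hcomp g h e).2⟩
  · change 𝒢.src (F.symm (𝒢.unit (𝒢.src (F (𝒢.unit x))))) = x
    rw [hF' _ (F (𝒢.unit x)) (𝒢.src_unit _), F.symm_apply_apply, 𝒢.src_unit]
  · change 𝒢.src (F (𝒢.unit (𝒢.src (F.symm (𝒢.unit x))))) = x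
    rw [hF _ (F.symm (𝒢.unit x)) (𝒢.src_unit _), F.apply_symm_apply, 𝒢.src_unit]
  · exact 𝒢.contMDiff_src.comp (F.contMDiff.comp 𝒢.contMDiff_unit)
  · exact 𝒢.contMDiff_src.comp (F.symm.contMDiff.comp 𝒢.contMDiff_unit)
  · exact hF _ _ (𝒢.src_unit _).symm
  · exact (hcomp (𝒢.unit (𝒢.tgt g)) g (𝒢.src_unit _)).1.symm

/-- The evolution of a family of multiplicative vector fields consists of automorphisms. -/
theorem isAutomorphism_evolution [IsManifold 𝓘(ℝ, E) ∞ G] [IsManifold 𝓘(ℝ, E₀) ∞ M] [T2Space G]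
    {J : Set ℝ} (hJ : IsOpen J) (hJ' : J.OrdConnected)
    {Z : ℝ → (g : G) → TangentSpace 𝓘(ℝ, E) g} (hZ : IsSmoothVectorFieldFamily J Z)
    (hc : ∀ t ∈ J, 𝒢.IsDeformationCocycle (Z t)) {P : ℝ → ℝ → G → G}
    (hP : ContMDiffOn (𝓘(ℝ, ℝ).prod (𝓘(ℝ, ℝ).prod 𝓘(ℝ, E))) 𝓘(ℝ, E) ∞
        (fun p : ℝ × ℝ × G => P p.1 p.2.1 p.2.2) (J ×ˢ J ×ˢ univ))
    (h0 : ∀ s ∈ J, ∀ x, P s s x = x) (hsol : ∀ s ∈ J, ∀ x, IsSolutionOn Z (fun t => P t s x) J)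
    (hcomp : ∀ r ∈ J, ∀ s ∈ J, ∀ t ∈ J, ∀ x, P t r (P r s x) = P t s x) {s t : ℝ} (hs : s ∈ J)
    (ht : t ∈ J) : 𝒢.IsAutomorphism (P t s) := by
  have hsm : ∀ s ∈ J, ∀ t ∈ J, ContMDiff 𝓘(ℝ, E) 𝓘(ℝ, E) ∞ (P t s) := by
    intro s hs t ht
    refine contMDiffOn_univ.1 (hP.comp (f := fun g : G => (t, s, g))
      (contMDiff_const.prodMk (contMDiff_const.prodMk contMDiff_id)).contMDiffOn
      fun g _ => ⟨ht, hs, mem_univ _⟩)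
  have hsrc : ∀ s ∈ J, ∀ t ∈ J, ∀ a b, 𝒢.src a = 𝒢.src b →
      𝒢.src (P t s a) = 𝒢.src (P t s b) := by
    intro s hs t ht a b e
    have := 𝒢.t2Space_objects
    -- Projectability makes the sources of two trajectories solutions of one equation on the
    -- objects, with the same initial value.
    have hb : ∀ a, IsSolutionOn (fun t => 𝒢.baseField (Z t)) (fun t => 𝒢.src (P t s a)) J := by
      intro a t ht
      have h1 := (hsol s hs a t ht).comp_curve
        ((𝒢.contMDiff_src.mdifferentiable (by simp)) (P t s a)).hasMFDerivAt
      have h2 := (hc t ht).1.mfderiv_src (P t s a)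
      exact h1.congr_mfderiv (congrArg (ContinuousLinearMap.toSpanSingleton ℝ) h2)
    exact (hb a).eqOn hJ (𝒢.isSmoothVectorFieldFamily_baseField hZ) hJ hJ' le_rfl (hb b) hs
      (by simpa only [h0 s hs] using e) ht
  have hdiv : ∀ s ∈ J, ∀ t ∈ J, ∀ a b, 𝒢.src a = 𝒢.src b →
      P t s (𝒢.div (a, b)) = 𝒢.div (P t s a, P t s b) := by
    intro s hs t ht a b e
    -- By `hsrc` the quotient remains defined along the trajectories, and by the cocycle identity it
    -- solves the equation, starting at the quotient of `a` by `b`.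
    have h1 : IsSolutionOn Z (fun t => 𝒢.div (P t s a, P t s b)) J := by
      intro t ht
      have h2 := 𝒢.hasMFDerivAt_div (hsol s hs a t ht) (hsol s hs b t ht)
        (Filter.eventually_of_mem (hJ.mem_nhds ht) fun τ hτ => hsrc s hs τ hτ a b e)
      exact h2.congr_mfderiv (congrArg (ContinuousLinearMap.toSpanSingleton ℝ)
        ((hc t ht).mfderivWithin_div (hsrc s hs t ht a b e)))
    exact (hsol s hs _).eqOn hJ hZ hJ hJ' le_rfl h1 hs (by simp only [h0 s hs]) ht
  let F : G ≃ₘ^∞⟮𝓘(ℝ, E), 𝓘(ℝ, E)⟯ G :=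
    ⟨⟨P t s, P s t, fun g => by rw [hcomp t ht s hs s hs, h0 s hs],
      fun g => by rw [hcomp s hs t ht t ht, h0 t ht]⟩, hsm s hs t ht, hsm t ht s hs⟩
  exact 𝒢.isAutomorphism_of_div F (hsrc s hs t ht) (hsrc t ht s hs) (hdiv s hs t ht)

end LieGroupoid

/-! ### Tangent lifts and the Lie derivative formula -/

section LieDerivative

open Filter Topology

theorem toSpanSingleton_prod {X Y : Type*} [NormedAddCommGroup X] [NormedSpace ℝ X]
    [NormedAddCommGroup Y] [NormedSpace ℝ Y] (x : X) (y : Y) :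
    (ContinuousLinearMap.toSpanSingleton ℝ x).prod (ContinuousLinearMap.toSpanSingleton ℝ y) =
      ContinuousLinearMap.toSpanSingleton ℝ (x, y) := by
  ext <;> simp

/-- The derivative of a map into the total space of a vector bundle, in terms of the projection and
of the preferred trivialization. -/
theorem HasMFDerivAt.totalSpace {EX : Type*} [NormedAddCommGroup EX] [NormedSpace ℝ EX]
    {HX : Type*} [TopologicalSpace HX] {IX : ModelWithCorners ℝ EX HX}
    {X : Type*} [TopologicalSpace X] [ChartedSpace HX X]
    {EB : Type*} [NormedAddCommGroup EB] [NormedSpace ℝ EB]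
    {HB : Type*} [TopologicalSpace HB] {IB : ModelWithCorners ℝ EB HB}
    {B : Type*} [TopologicalSpace B] [ChartedSpace HB B]
    {F : Type*} [NormedAddCommGroup F] [NormedSpace ℝ F]
    {V : B → Type*} [TopologicalSpace (Bundle.TotalSpace F V)] [∀ b, TopologicalSpace (V b)]
    [FiberBundle F V] {f : X → Bundle.TotalSpace F V} {x : X}
    {A : EX →L[ℝ] EB} {D : EX →L[ℝ] F}
    (hA : HasMFDerivAt IX IB (fun y => (f y).proj) x A)
    (hD : HasMFDerivAt IX 𝓘(ℝ, F) (fun y => (trivializationAt F V (f x).proj (f y)).2) x D) :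
    HasMFDerivAt IX (IB.prod 𝓘(ℝ, F)) f x (A.prod D) := by
  refine ⟨(FiberBundle.continuousAt_totalSpace F f).2 ⟨hA.continuousAt, hD.continuousAt⟩, ?_⟩
  have h := hA.2.prodMk hD.2
  have hev : ∀ᶠ y in 𝓝 x, (f y).proj ∈ (trivializationAt F V (f x).proj).baseSet :=
    hA.continuousAt.eventually_mem ((trivializationAt F V (f x).proj).open_baseSet.mem_nhds
      (FiberBundle.mem_baseSet_trivializationAt' _))
  have hs : Tendsto (extChartAt IX x).symm (𝓝[range IX] (extChartAt IX x x)) (𝓝 x) := by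
    have := (continuousAt_extChartAt_symm (I := IX) x).continuousWithinAt (s := range IX)
    rwa [ContinuousWithinAt, extChartAt_to_inv] at this
  have e : ∀ z : X, (f z).proj ∈ (trivializationAt F V (f x).proj).baseSet →
      extChartAt (IB.prod 𝓘(ℝ, F)) (f x) (f z) = (extChartAt IB (f x).proj (f z).proj,
        (trivializationAt F V (f x).proj (f z)).2) := by
    intro z hz
    rw [FiberBundle.extChartAt]
    refine Prod.ext ?_ rfl
    change extChartAt IB (f x).proj (trivializationAt F V (f x).proj (f z)).1 = _
    rw [(trivializationAt F V (f x).proj).coe_fst' hz]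
  refine h.congr_of_eventuallyEq ?_ ?_
  · filter_upwards [hs.eventually hev] with y hy
    exact e _ hy
  · have := e ((extChartAt IX x).symm (extChartAt IX x x))
      (by rw [extChartAt_to_inv]; exact hev.self_of_nhds)
    exact this

variable {E : Type u} [NormedAddCommGroup E] [NormedSpace ℝ E]
  {G : Type w₁} [TopologicalSpace G] [ChartedSpace E G] [IsManifold 𝓘(ℝ, E) ∞ G] {k : ℕ}

/-- Expressing fibre coordinates through derivatives of charts makes the coordinate computations
below instances of the chain rule. -/
theorem trivializationAt_tangentBundle_snd {x : G} (p : TangentBundle 𝓘(ℝ, E) G)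
    (hp : p.1 ∈ (chartAt E x).source) :
    (trivializationAt E (TangentSpace 𝓘(ℝ, E)) x p).2 =
      mfderiv 𝓘(ℝ, E) 𝓘(ℝ, E) (extChartAt 𝓘(ℝ, E) x) p.1 p.2 := by
  have : IsManifold 𝓘(ℝ, E) 1 G := .of_le (n := ∞) (by simp)
  have h := TangentBundle.continuousLinearMapAt_trivializationAt (𝕜 := ℝ) (I := 𝓘(ℝ, E)) hp
  have h' := congrArg (fun L : E →L[ℝ] E => L p.2) h
  refine Eq.trans ?_ h'
  exact (congrFun ((trivializationAt E (TangentSpace 𝓘(ℝ, E)) x).coe_linearMapAt_of_mem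
    (R := ℝ) hp) p.2).symm

theorem trivializationAt_tangentPower_snd {x : G} (p : TangentPower E G k)
    (hp : p.1 ∈ (chartAt E x).source) :
    (trivializationAt (Fin k → E) (tangentPowerCore E G k).Fiber x p).2 = fun i =>
      (mfderiv 𝓘(ℝ, E) 𝓘(ℝ, E) (extChartAt 𝓘(ℝ, E) x) p.1 ((p.2 : Fin k → E) i) : E) := by
  funext i
  exact trivializationAt_tangentBundle_snd (⟨p.1, (p.2 : Fin k → E) i⟩ : TangentBundle 𝓘(ℝ, E) G) hp

/-- The velocity of the curve of `k`-tuples of vectors obtained by moving a `k`-tuple of vectors by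
a smooth family of maps which starts at the identity with velocity `Y` is the tangent lift of `Y`. -/
theorem hasMFDerivAt_tangentPower_curve {Ψ : ℝ → G → G} {t₀ : ℝ} {g : G}
    (hΨ : ContMDiffAt (𝓘(ℝ, ℝ).prod 𝓘(ℝ, E)) 𝓘(ℝ, E) ∞ (fun q : ℝ × G => Ψ q.1 q.2) (t₀, g))
    (h0 : ∀ x, Ψ t₀ x = x) {Y : (x : G) → TangentSpace 𝓘(ℝ, E) x}
    (hY : ∀ x, HasMFDerivAt 𝓘(ℝ, ℝ) 𝓘(ℝ, E) (fun τ => Ψ τ x) t₀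
      (ContinuousLinearMap.toSpanSingleton ℝ (Y x : E))) (v : Fin k → E) :
    HasMFDerivAt 𝓘(ℝ, ℝ) (𝓘(ℝ, E).prod 𝓘(ℝ, Fin k → E))
      (fun τ => (⟨Ψ τ g, fun i => (mfderiv 𝓘(ℝ, E) 𝓘(ℝ, E) (Ψ τ) g (v i) : E)⟩ :
        TangentPower E G k)) t₀
      (ContinuousLinearMap.toSpanSingleton ℝ
        (tangentPowerLift k Y (⟨g, v⟩ : TangentPower E G k) : E × (Fin k → E))) := by
  have : IsManifold 𝓘(ℝ, E) 1 G := .of_le (n := ∞) (by simp)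
  let φ := extChartAt 𝓘(ℝ, E) g
  have hg : g ∈ φ.source := mem_extChartAt_source g
  have hφo : IsOpen φ.source := isOpen_extChartAt_source g
  have hφg : φ.symm (φ g) = g := φ.left_inv hg
  let F : ℝ × E → E := fun p => φ (Ψ p.1 (φ.symm p.2))
  -- the coordinate expression is smooth
  have hF : ContDiffAt ℝ ∞ F (t₀, φ g) := by
    have h1 : ContMDiffAt 𝓘(ℝ, ℝ × E) (𝓘(ℝ, ℝ).prod 𝓘(ℝ, E)) ∞
        (fun p : ℝ × E => (p.1, φ.symm p.2)) (t₀, φ g) := by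
      refine contDiff_fst.contMDiff.contMDiffAt.prodMk (ContMDiffAt.comp _ ?_
        contDiff_snd.contMDiff.contMDiffAt)
      exact (contMDiffOn_extChartAt_symm g).contMDiffAt (extChartAt_target_mem_nhds (I := 𝓘(ℝ, E)) g)
    have h2 : ContMDiffAt 𝓘(ℝ, ℝ × E) 𝓘(ℝ, E) ∞
        (fun p : ℝ × E => Ψ p.1 (φ.symm p.2)) (t₀, φ g) := by
      refine ContMDiffAt.comp (t₀, φ g) (g := fun q : ℝ × G => Ψ q.1 q.2) ?_ h1
      simpa only [hφg] using hΨ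
    have h3 : ContMDiffAt 𝓘(ℝ, E) 𝓘(ℝ, E) ∞ φ (Ψ t₀ (φ.symm (φ g))) := by
      rw [hφg, h0]
      exact contMDiffAt_extChartAt
    exact (h3.comp (t₀, φ g) h2).contDiffAt
  have hFd : ∀ᶠ p in 𝓝 (t₀, φ g), HasFDerivAt F (fderiv ℝ F p) p :=
    ((hF.of_le (m := 1) (by simp)).eventually (by simp)).mono fun p hp =>
      (hp.differentiableAt (by simp)).hasFDerivAt
  have hF' : HasFDerivAt (fderiv ℝ F) (fderiv ℝ (fderiv ℝ F) (t₀, φ g)) (t₀, φ g) :=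
    ((hF.fderiv_right (m := 1)
      (WithTop.coe_le_coe.2 (le_top : (1 + 1 : ℕ∞) ≤ ⊤))).differentiableAt (by simp)).hasFDerivAt
  let S := fderiv ℝ (fderiv ℝ F) (t₀, φ g)
  -- The crux: the `τ`-derivative of the moved vector is `S (1, 0) (0, v i)`, while the lift of `Y`
  -- contains `S (0, v i) (1, 0)`, the derivative of the velocity field along `v i`.
  have hsymm : ∀ v w, S v w = S w v := (hF.isSymmSndFDerivAt (by
    rw [minSmoothness_of_isRCLikeNormedField]
    exact WithTop.coe_le_coe.2 (le_top : (2 : ℕ∞) ≤ ⊤))).eq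
  -- the vector field in coordinates
  let y : E → E := fun q => mfderiv 𝓘(ℝ, E) 𝓘(ℝ, E) φ (φ.symm q) (Y (φ.symm q))
  have hy : HasFDerivAt y (S.flip ((1 : ℝ), (0 : E)) ∘L ContinuousLinearMap.inr ℝ ℝ E) (φ g) := by
    have h1 : HasFDerivAt (fun q : E => fderiv ℝ F (t₀, q) (1, 0))
        (S.flip ((1 : ℝ), (0 : E)) ∘L ContinuousLinearMap.inr ℝ ℝ E) (φ g) := by
      have h2 := hF'.comp (φ g) (hasFDerivAt_prodMk_right t₀ (φ g))
      exact h2.clm_apply (hasFDerivAt_const ((1 : ℝ), (0 : E)) (φ g)) |>.congr_fderiv (by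
        ext; simp [S])
    refine h1.congr_of_eventuallyEq ?_
    have hc : Tendsto (fun q : E => (t₀, q)) (𝓝 (φ g)) (𝓝 (t₀, φ g)) :=
      (Continuous.prodMk_right t₀).tendsto _
    filter_upwards [hc.eventually hFd, extChartAt_target_mem_nhds (I := 𝓘(ℝ, E)) g] with q hq hqt
    have h2 : HasDerivAt (fun τ => F (τ, q)) (fderiv ℝ F (t₀, q) (1, 0)) t₀ := by
      have := hq.comp_hasDerivAt t₀ ((hasDerivAt_id t₀).prodMk (hasDerivAt_const t₀ q))
      exact this
    have hsrc : φ.symm q ∈ φ.source := φ.map_target hqt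
    have h3 := hasDerivAt_extChartAt_comp (x := g) (hY (φ.symm q)) (by rw [h0]; exact hsrc)
    have h4 := congrArg (fun z => (mfderiv 𝓘(ℝ, E) 𝓘(ℝ, E) φ z : E →L[ℝ] E) (Y (φ.symm q)))
      (h0 (φ.symm q))
    exact h4.symm.trans (h3.unique h2)
  -- the lift of the vector field
  have hYm : HasMFDerivAt 𝓘(ℝ, E) 𝓘(ℝ, E).tangent
      (fun x => (⟨x, Y x⟩ : TangentBundle 𝓘(ℝ, E) G)) g
      ((ContinuousLinearMap.id ℝ E).prod
        (S.flip ((1 : ℝ), (0 : E)) ∘L ContinuousLinearMap.inr ℝ ℝ E)) := by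
    refine HasMFDerivAt.totalSpace (hasMFDerivAt_id g) ?_
    have h1 : HasMFDerivAt 𝓘(ℝ, E) 𝓘(ℝ, E) φ g (ContinuousLinearMap.id ℝ E) := by
      have h2 := (mdifferentiableAt_extChartAt (I := 𝓘(ℝ, E)) (mem_chart_source E g)).hasMFDerivAt
      rwa [mfderiv_extChartAt_self] at h2
    have h2 := (hy.hasMFDerivAt.comp g h1).congr_mfderiv
      (ContinuousLinearMap.comp_id
        (S.flip ((1 : ℝ), (0 : E)) ∘L ContinuousLinearMap.inr ℝ ℝ E))
    refine h2.congr_of_eventuallyEq ?_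
    filter_upwards [hφo.mem_nhds hg] with x hx
    have h3 := trivializationAt_tangentBundle_snd (x := g) (⟨x, Y x⟩ : TangentBundle 𝓘(ℝ, E) G)
      (by rwa [← extChartAt_source 𝓘(ℝ, E)])
    refine h3.trans ?_
    change _ = mfderiv 𝓘(ℝ, E) 𝓘(ℝ, E) φ (φ.symm (φ x)) (Y (φ.symm (φ x)))
    rw [φ.left_inv hx]
  have hlift : (tangentPowerLift k Y (⟨g, v⟩ : TangentPower E G k) : E × (Fin k → E)) =
      ((Y g : E), fun i => S (0, v i) (1, 0)) := by
    refine Prod.ext rfl (funext fun i => ?_)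
    change ((mfderiv 𝓘(ℝ, E) 𝓘(ℝ, E).tangent
      (fun x => (⟨x, Y x⟩ : TangentBundle 𝓘(ℝ, E) G)) g (v i) : E × E)).2 = _
    rw [hYm.mfderiv]
    rfl
  rw [hlift]
  refine (HasMFDerivAt.totalSpace (hY g) ?_).congr_mfderiv (toSpanSingleton_prod (X := E) (Y g)
    (fun i => S (0, v i) (1, 0)))
  have hd : HasDerivAt (fun τ => fun i => fderiv ℝ F (τ, φ g) (0, v i))
      (fun i => S (0, v i) (1, 0)) t₀ := by
    refine hasDerivAt_pi.2 fun i => ?_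
    have h2 := hF'.comp_hasDerivAt t₀ ((hasDerivAt_id t₀).prodMk (hasDerivAt_const t₀ (φ g)))
    have h3 := h2.clm_apply (hasDerivAt_const t₀ ((0 : ℝ), v i))
    rw [map_zero, add_zero] at h3
    rw [hsymm]
    exact h3
  refine hd.hasFDerivAt.hasMFDerivAt.congr_of_eventuallyEq ?_
  have hc : ContMDiffAt 𝓘(ℝ, ℝ) (𝓘(ℝ, ℝ).prod 𝓘(ℝ, E)) ∞ (fun τ : ℝ => (τ, g)) t₀ :=
    contMDiffAt_id.prodMk contMDiffAt_const
  have h1 : ∀ᶠ τ in 𝓝 t₀, Ψ τ g ∈ φ.source :=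
    (hY g).continuousAt.eventually_mem (hφo.mem_nhds (by rw [h0]; exact hg))
  have h2 : ∀ᶠ τ in 𝓝 t₀, ContMDiffAt (𝓘(ℝ, ℝ).prod 𝓘(ℝ, E)) 𝓘(ℝ, E) 1
      (fun q : ℝ × G => Ψ q.1 q.2) (τ, g) :=
    hc.continuousAt.eventually
      ((contMDiffAt_iff_contMDiffAt_nhds (by simp)).1 (hΨ.of_le (by simp)))
  have hcF : Tendsto (fun τ : ℝ => (τ, φ g)) (𝓝 t₀) (𝓝 (t₀, φ g)) :=
    (Continuous.prodMk_left (φ g)).tendsto _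
  filter_upwards [h1, h2, hcF.eventually hFd] with τ hτ1 hτ2 hτ3
  simp only [h0]
  rw [trivializationAt_tangentPower_snd _ (by rwa [← extChartAt_source 𝓘(ℝ, E)])]
  funext i
  have hΨτ : HasMFDerivAt 𝓘(ℝ, E) 𝓘(ℝ, E) (Ψ τ) g (mfderiv 𝓘(ℝ, E) 𝓘(ℝ, E) (Ψ τ) g) := by
    refine MDifferentiableAt.hasMFDerivAt ?_
    exact (hτ2.comp g (f := fun x : G => (τ, x))
      (contMDiffAt_const.prodMk contMDiffAt_id)).mdifferentiableAt (by simp)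
  have hφτ := (mdifferentiableAt_extChartAt (I := 𝓘(ℝ, E)) (x := g) (y := Ψ τ g)
    (by rwa [← extChartAt_source 𝓘(ℝ, E)])).hasMFDerivAt
  have hφs : HasMFDerivAt 𝓘(ℝ, E) 𝓘(ℝ, E) φ.symm (φ g) (ContinuousLinearMap.id ℝ E) := by
    have h3 := (mdifferentiableWithinAt_extChartAt_symm (I := 𝓘(ℝ, E))
      (mem_extChartAt_target g)).hasMFDerivWithinAt
    rw [mfderivWithin_range_extChartAt_symm, modelWithCornersSelf_coe, range_id] at h3
    exact hasMFDerivWithinAt_univ.1 h3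
  have hΨφ : ∀ x, x = g → HasMFDerivAt 𝓘(ℝ, E) 𝓘(ℝ, E) (fun x => φ (Ψ τ x)) x
      (mfderiv 𝓘(ℝ, E) 𝓘(ℝ, E) φ (Ψ τ g) ∘L mfderiv 𝓘(ℝ, E) 𝓘(ℝ, E) (Ψ τ) g : E →L[ℝ] E) := by
    rintro x rfl
    exact hφτ.comp _ hΨτ
  have h3 := hasMFDerivAt_iff_hasFDerivAt.1 ((hΨφ _ hφg).comp (φ g) hφs)
  have h4 := hτ3.comp (φ g) (hasFDerivAt_prodMk_right τ (φ g))
  exact congrArg (fun L : E →L[ℝ] E => L (v i)) (HasFDerivAt.unique h3 h4)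

/-- The derivative of the pull-backs of a family of forms along a family of maps which starts at the
identity. -/
theorem IsSmoothFormFamily.hasDerivAt_pullback {J : Set ℝ} (hJ : IsOpen J) {α : ℝ → KForm E G k}
    (hα : IsSmoothFormFamily J α) {Ψ : ℝ → G → G} {t₀ : ℝ} (ht₀ : t₀ ∈ J) {g : G}
    (hΨ : ContMDiffAt (𝓘(ℝ, ℝ).prod 𝓘(ℝ, E)) 𝓘(ℝ, E) ∞ (fun q : ℝ × G => Ψ q.1 q.2) (t₀, g))
    (h0 : ∀ x, Ψ t₀ x = x) {Y : (x : G) → TangentSpace 𝓘(ℝ, E) x}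
    (hY : ∀ x, HasMFDerivAt 𝓘(ℝ, ℝ) 𝓘(ℝ, E) (fun τ => Ψ τ x) t₀
      (ContinuousLinearMap.toSpanSingleton ℝ (Y x : E))) (v : Fin k → TangentSpace 𝓘(ℝ, E) g) :
    HasDerivAt (fun τ => (α τ).pullback (Ψ τ) g v)
      (deriv (fun τ => α τ g v) t₀ + (α t₀).push (tangentPowerLift k Y) ⟨g, v⟩) t₀ := by
  let p : TangentPower E G k := ⟨g, v⟩
  let u : E × (Fin k → E) := tangentPowerLift k Y p
  have hsm : ContMDiffAt (𝓘(ℝ, ℝ).prod (𝓘(ℝ, E).prod 𝓘(ℝ, Fin k → E))) 𝓘(ℝ, ℝ) ∞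
      (fun q : ℝ × TangentPower E G k => (α q.1).hat q.2) (t₀, p) :=
    ContMDiffOn.contMDiffAt hα ((hJ.prod isOpen_univ).mem_nhds ⟨ht₀, mem_univ _⟩)
  obtain ⟨L, hL⟩ : ∃ L : ℝ × (E × (Fin k → E)) →L[ℝ] ℝ,
      HasMFDerivAt (𝓘(ℝ, ℝ).prod (𝓘(ℝ, E).prod 𝓘(ℝ, Fin k → E))) 𝓘(ℝ, ℝ)
        (fun q : ℝ × TangentPower E G k => (α q.1).hat q.2) (t₀, p) L :=
    ⟨_, (hsm.mdifferentiableAt (by simp)).hasMFDerivAt⟩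
  -- All terms come from the single total derivative `L`: the full curve gives `L (1, u)`, the
  -- constant curve gives `L (1, 0)`, and freezing the time gives `L (0, u)`.
  have hcurve : ∀ (c : ℝ → TangentPower E G k) (w : E × (Fin k → E)), c t₀ = p →
      HasMFDerivAt 𝓘(ℝ, ℝ) (𝓘(ℝ, E).prod 𝓘(ℝ, Fin k → E)) c t₀
        (ContinuousLinearMap.toSpanSingleton ℝ w) →
      HasDerivAt (fun τ => (α τ).hat (c τ)) (L (1, w)) t₀ := by
    intro c w hc h
    have h1 : HasMFDerivAt 𝓘(ℝ, ℝ) (𝓘(ℝ, ℝ).prod (𝓘(ℝ, E).prod 𝓘(ℝ, Fin k → E)))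
        (fun τ => (τ, c τ)) t₀ (ContinuousLinearMap.toSpanSingleton ℝ ((1 : ℝ), w)) :=
      ((hasMFDerivAt_id t₀).prodMk h).congr_mfderiv
        ((congrArg (fun A : ℝ →L[ℝ] ℝ => A.prod (ContinuousLinearMap.toSpanSingleton ℝ w))
          (ContinuousLinearMap.ext fun x => (mul_one x).symm : ContinuousLinearMap.id ℝ ℝ =
            ContinuousLinearMap.toSpanSingleton ℝ 1)).trans (toSpanSingleton_prod (1 : ℝ) w))
    rw [← hc] at hL
    exact hasMFDerivAt_iff_hasFDerivAt.1 (h1.comp_curve hL)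
  have hc := hasMFDerivAt_tangentPower_curve hΨ h0 hY v
  have hid : Ψ t₀ = id := funext h0
  have hc0 : (⟨Ψ t₀ g, fun i => (mfderiv 𝓘(ℝ, E) 𝓘(ℝ, E) (Ψ t₀) g (v i) : E)⟩ :
      TangentPower E G k) = p := by
    rw [hid, mfderiv_id]
    rfl
  have h1 := hcurve _ u hc0 hc
  have h2 : deriv (fun τ => α τ g v) t₀ = L (1, 0) := by
    refine HasDerivAt.deriv (hcurve (fun _ => p) 0 rfl ?_)
    exact (hasMFDerivAt_const p t₀).congr_mfderiv
      (ContinuousLinearMap.toSpanSingleton_zero (R₁ := ℝ) (M₁ := E × (Fin k → E))).symm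
  have h3 : (α t₀).push (tangentPowerLift k Y) p = L (0, u) := by
    have h4 : HasMFDerivAt (𝓘(ℝ, E).prod 𝓘(ℝ, Fin k → E))
        (𝓘(ℝ, ℝ).prod (𝓘(ℝ, E).prod 𝓘(ℝ, Fin k → E)))
        (fun q : TangentPower E G k => (t₀, q)) p (ContinuousLinearMap.inr ℝ ℝ _) :=
      (hasMFDerivAt_const t₀ p).prodMk (hasMFDerivAt_id p)
    have h5 : HasMFDerivAt (𝓘(ℝ, E).prod 𝓘(ℝ, Fin k → E)) 𝓘(ℝ, ℝ) (α t₀).hat p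
        (L ∘L ContinuousLinearMap.inr ℝ ℝ _) := hL.comp p h4
    rw [KForm.push, h5.mfderiv]
    rfl
  rw [h2]
  change HasDerivAt _ (L (1, 0) + (α t₀).push (tangentPowerLift k Y) p) t₀
  rw [h3, ← map_add, Prod.mk_add_mk, add_zero, zero_add]
  exact h1

end LieDerivative

/-! ### Functoriality of pull-back, and sign changes -/

section FormLemmas

open Filter Topology

variable {E : Type u} [NormedAddCommGroup E] [NormedSpace ℝ E]
  {G : Type w₁} [TopologicalSpace G] [ChartedSpace E G] {k : ℕ}

theorem KForm.pullback_id (α : KForm E G k) : α.pullback id = α := by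
  funext g
  ext v
  simp only [KForm.pullback, mfderiv_id]
  rfl

theorem KForm.pullback_comp (α : KForm E G k) {φ ψ : G → G}
    (hψ : MDifferentiable 𝓘(ℝ, E) 𝓘(ℝ, E) ψ) (hφ : MDifferentiable 𝓘(ℝ, E) 𝓘(ℝ, E) φ) :
    α.pullback (ψ ∘ φ) = (α.pullback ψ).pullback φ := by
  funext g
  ext v
  simp only [KForm.pullback]
  rw [mfderiv_comp g (hψ (φ g)) (hφ g)]
  rfl

variable [IsManifold 𝓘(ℝ, E) ∞ G]

theorem trivializationAt_tangentBundle_neg {x y : G} (hy : y ∈ (chartAt E x).source)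
    (v : TangentSpace 𝓘(ℝ, E) y) :
    (trivializationAt E (TangentSpace 𝓘(ℝ, E)) x (⟨y, -v⟩ : TangentBundle 𝓘(ℝ, E) G)).2 =
      -(trivializationAt E (TangentSpace 𝓘(ℝ, E)) x (⟨y, v⟩ : TangentBundle 𝓘(ℝ, E) G)).2 := by
  rw [trivializationAt_tangentBundle_snd _ hy, trivializationAt_tangentBundle_snd _ hy]
  exact map_neg (mfderiv 𝓘(ℝ, E) 𝓘(ℝ, E) (extChartAt 𝓘(ℝ, E) x) y) v

theorem IsSmoothVectorFieldFamily.neg {J : Set ℝ} {Z : ℝ → (g : G) → TangentSpace 𝓘(ℝ, E) g}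
    (hZ : IsSmoothVectorFieldFamily J Z) : IsSmoothVectorFieldFamily J fun t g => -Z t g := by
  intro q hq
  have h := (Bundle.contMDiffWithinAt_totalSpace).1 (hZ q hq)
  refine (Bundle.contMDiffWithinAt_totalSpace).2 ⟨h.1, h.2.neg.congr_of_eventuallyEq ?_ ?_⟩
  · have : ∀ᶠ p : ℝ × G in 𝓝 q, p.2 ∈ (chartAt E q.2).source :=
      continuous_snd.continuousAt.eventually_mem
        ((chartAt E q.2).open_source.mem_nhds (mem_chart_source E q.2))
    filter_upwards [nhdsWithin_le_nhds this] with p hp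
    exact trivializationAt_tangentBundle_neg hp _
  · exact trivializationAt_tangentBundle_neg (mem_chart_source E q.2) _

theorem IsSmoothVectorFieldFamily.mdifferentiableAt {J : Set ℝ}
    {Z : ℝ → (g : G) → TangentSpace 𝓘(ℝ, E) g} (hZ : IsSmoothVectorFieldFamily J Z) {t : ℝ}
    (ht : t ∈ J) (g : G) : MDifferentiableAt 𝓘(ℝ, E) 𝓘(ℝ, E).tangent
      (fun g => (⟨g, Z t g⟩ : TangentBundle 𝓘(ℝ, E) G)) g := by
  have hZ' : ContMDiffOn _ _ _ _ _ := hZ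
  have h1 : ContMDiffOn 𝓘(ℝ, E) 𝓘(ℝ, E).tangent ∞
      (fun g => (⟨g, Z t g⟩ : TangentBundle 𝓘(ℝ, E) G)) univ :=
    hZ'.comp (f := fun g : G => (t, g)) (contMDiff_const.prodMk contMDiff_id).contMDiffOn
      fun g _ => ⟨ht, mem_univ _⟩
  exact (contMDiffOn_univ.1 h1).mdifferentiable (by simp) g

/-- A section takes values in the manifold `TG`, so linearity of the derivative is available only
for its fibre coordinate in a trivialization. Moser's argument needs this because it integrates
`-Z`. -/
theorem tangentPowerLift_neg {Z : (g : G) → TangentSpace 𝓘(ℝ, E) g} {g : G}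
    (hZ : MDifferentiableAt 𝓘(ℝ, E) 𝓘(ℝ, E).tangent
      (fun g => (⟨g, Z g⟩ : TangentBundle 𝓘(ℝ, E) G)) g) (v : Fin k → E) :
    tangentPowerLift k (fun g => -Z g) (⟨g, v⟩ : TangentPower E G k) =
      -tangentPowerLift k Z ⟨g, v⟩ := by
  have h := ((mdifferentiableAt_totalSpace _ _).1 hZ).2.hasMFDerivAt
  have h1 := HasMFDerivAt.totalSpace (f := fun g => (⟨g, Z g⟩ : TangentBundle 𝓘(ℝ, E) G))
    (hasMFDerivAt_id g) h
  have h2 := HasMFDerivAt.totalSpace (f := fun g => (⟨g, -Z g⟩ : TangentBundle 𝓘(ℝ, E) G))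
    (hasMFDerivAt_id g) (h.neg.congr_of_eventuallyEq (by
      filter_upwards [(chartAt E g).open_source.mem_nhds (mem_chart_source E g)] with x hx
      exact trivializationAt_tangentBundle_neg hx _))
  refine Prod.ext rfl (funext fun i => ?_)
  change ((mfderiv 𝓘(ℝ, E) 𝓘(ℝ, E).tangent
      (fun x => (⟨x, -Z x⟩ : TangentBundle 𝓘(ℝ, E) G)) g (v i) : E × E)).2 =
    -((mfderiv 𝓘(ℝ, E) 𝓘(ℝ, E).tangent
      (fun x => (⟨x, Z x⟩ : TangentBundle 𝓘(ℝ, E) G)) g (v i) : E × E)).2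
  rw [h1.mfderiv, h2.mfderiv]
  rfl

theorem KForm.push_tangentPowerLift_neg (α : KForm E G k) {Z : (g : G) → TangentSpace 𝓘(ℝ, E) g}
    {g : G} (hZ : MDifferentiableAt 𝓘(ℝ, E) 𝓘(ℝ, E).tangent
      (fun g => (⟨g, Z g⟩ : TangentBundle 𝓘(ℝ, E) G)) g) (v : Fin k → E) :
    α.push (tangentPowerLift k fun g => -Z g) ⟨g, v⟩ =
      -α.push (tangentPowerLift k Z) (⟨g, v⟩ : TangentPower E G k) := by
  rw [KForm.push, tangentPowerLift_neg hZ]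
  exact map_neg (mfderiv (𝓘(ℝ, E).prod 𝓘(ℝ, Fin k → E)) 𝓘(ℝ, ℝ) α.hat _) _

end FormLemmas

/-! ### Moser's argument -/

namespace LieGroupoid

open Filter Topology

variable {E : Type u} [NormedAddCommGroup E] [NormedSpace ℝ E]
  {E₀ : Type v} [NormedAddCommGroup E₀] [NormedSpace ℝ E₀]
  {G : Type w₁} [TopologicalSpace G] [ChartedSpace E G]
  {M : Type w₂} [TopologicalSpace M] [ChartedSpace E₀ M]
  {𝒢 : LieGroupoid E E₀ G M} {J : Set ℝ} {k : ℕ}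

theorem IsDeformationCocycle.neg {Z : (g : G) → TangentSpace 𝓘(ℝ, E) g}
    (hZ : 𝒢.IsDeformationCocycle Z) : 𝒢.IsDeformationCocycle fun g => -Z g := by
  obtain ⟨⟨V, hV⟩, hZ⟩ := hZ
  refine ⟨⟨fun x => -V x, fun g => ?_⟩, fun g h e => ?_⟩
  · rw [map_neg, hV]
  · have h1 := congrArg (fun p : TangentBundle 𝓘(ℝ, E) G => (⟨p.1, -p.2⟩ : TangentBundle 𝓘(ℝ, E) G))
      (hZ g h e)
    refine Eq.trans ?_ h1
    refine congrArg (fun w : E => (⟨𝒢.div (𝒢.mul g h, h), w⟩ : TangentBundle 𝓘(ℝ, E) G)) ?_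
    exact map_neg (mfderivWithin (𝓘(ℝ, E).prod 𝓘(ℝ, E)) 𝓘(ℝ, E) 𝒢.div 𝒢.divisible
      (𝒢.mul g h, h) : E × E →L[ℝ] E) ((Z (𝒢.mul g h), Z h) : E × E)

variable [IsManifold 𝓘(ℝ, E) ∞ G] [IsManifold 𝓘(ℝ, E₀) ∞ M]

/-- Moser's argument: a family of multiplicative vector fields that are primitives of the derivative
of the deformation integrates to a family of automorphisms. -/
theorem IsDeformation.exists_isSmoothAutomorphismFamily [FiniteDimensional ℝ E] [CompactSpace G]
    [T2Space G] (hJ : IsOpen J) (hJ' : J.OrdConnected) (hJ0 : (0 : ℝ) ∈ J) {α₀ : KForm E G k}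
    {α : ℝ → KForm E G k} (hα : 𝒢.IsDeformation J α₀ α)
    {Z : ℝ → (g : G) → TangentSpace 𝓘(ℝ, E) g} (hZ : IsSmoothVectorFieldFamily J Z)
    (hc : ∀ ε ∈ J, 𝒢.IsDeformationCocycle (Z ε))
    (hd : ∀ ε ∈ J, ∀ (g : G) (v : Fin k → TangentSpace 𝓘(ℝ, E) g),
      (α ε).push (tangentPowerLift k (Z ε)) ⟨g, v⟩ = deriv (fun τ => α τ g v) ε) :
    ∃ Φ : ℝ → G → G, 𝒢.IsSmoothAutomorphismFamily J Φ ∧ (∀ g, Φ 0 g = g) ∧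
      ∀ ε ∈ J, α ε = α₀.pullback (Φ ε) := by
  obtain ⟨P, hP, h0, hsol, hcomp⟩ := hZ.neg.exists_evolution hJ hJ'
  have hsm : ∀ s ∈ J, ∀ t ∈ J, MDifferentiable 𝓘(ℝ, E) 𝓘(ℝ, E) (P t s) := by
    intro s hs t ht
    have h1 := hP.comp (f := fun g : G => (t, s, g)) (s := univ)
      (contMDiff_const.prodMk (contMDiff_const.prodMk contMDiff_id)).contMDiffOn
      fun g _ => ⟨ht, hs, mem_univ _⟩
    exact (contMDiffOn_univ.1 h1).mdifferentiable (by simp)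
  -- `Φ ε` runs the evolution of `-Z` backwards, from time `ε` to time `0`, so that `(P τ ε)^* α τ`
  -- joins `α ε` at `τ = ε` to `(Φ ε)^* α₀` at `τ = 0`.
  refine ⟨fun ε => P 0 ε, ⟨?_, fun ε hε => 𝒢.isAutomorphism_evolution hJ hJ' hZ.neg
    (fun t ht => (hc t ht).neg) hP h0 hsol hcomp hε hJ0⟩, h0 0 hJ0, fun ε hε => ?_⟩
  · exact hP.comp (f := fun q : ℝ × G => ((0 : ℝ), q)) (contMDiff_const.prodMk contMDiff_id).contMDiffOn
      fun q hq => ⟨hJ0, hq⟩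
  · funext g
    ext v
    have hder : ∀ t ∈ J, HasDerivAt (fun τ => (α τ).pullback (P τ ε) g v) 0 t := by
      intro t ht
      have hΨ : ContMDiffAt (𝓘(ℝ, ℝ).prod 𝓘(ℝ, E)) 𝓘(ℝ, E) ∞ (fun q : ℝ × G => P q.1 t q.2)
          (t, P t ε g) := by
        have h1 : ContMDiffAt (𝓘(ℝ, ℝ).prod 𝓘(ℝ, E)) (𝓘(ℝ, ℝ).prod (𝓘(ℝ, ℝ).prod 𝓘(ℝ, E))) ∞
            (fun q : ℝ × G => (q.1, t, q.2)) (t, P t ε g) :=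
          contMDiffAt_fst.prodMk (contMDiffAt_const.prodMk contMDiffAt_snd)
        exact ContMDiffAt.comp (t, P t ε g) (g := fun p : ℝ × ℝ × G => P p.1 p.2.1 p.2.2)
          (hP.contMDiffAt ((hJ.prod (hJ.prod isOpen_univ)).mem_nhds ⟨ht, ht, mem_univ _⟩)) h1
      have hY : ∀ x, HasMFDerivAt 𝓘(ℝ, ℝ) 𝓘(ℝ, E) (fun τ => P τ t x) t
          (ContinuousLinearMap.toSpanSingleton ℝ (-Z t x : E)) := fun x =>
        (hsol t ht x t ht).congr_mfderiv
          (congrArg (fun y => ContinuousLinearMap.toSpanSingleton ℝ (-Z t y : E)) (h0 t ht x))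
      have h1 := hα.smooth.hasDerivAt_pullback (Ψ := fun τ x => P τ t x) (Y := fun x => -Z t x) hJ ht hΨ
        (h0 t ht) hY
        (fun i => mfderiv 𝓘(ℝ, E) 𝓘(ℝ, E) (P t ε) g (v i))
      have h2 : (α t).push (tangentPowerLift k fun x => -Z t x)
          (⟨P t ε g, fun i => mfderiv 𝓘(ℝ, E) 𝓘(ℝ, E) (P t ε) g (v i)⟩ : TangentPower E G k) = _ :=
        (α t).push_tangentPowerLift_neg (hZ.mdifferentiableAt ht (P t ε g)) _
      refine (h1.congr_deriv ((congrArg₂ (· + ·) rfl (h2.trans (congrArg Neg.neg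
        (hd t ht _ _)))).trans (add_neg_cancel _))).congr_of_eventuallyEq ?_
      filter_upwards [hJ.mem_nhds ht] with τ hτ
      -- This factorization reduces the derivative at `t` to that of a family through the identity,
      -- evaluated on the vectors already moved by `P t ε`.
      have h2 : P τ ε = P τ t ∘ P t ε := funext fun x => (hcomp t ht ε hε τ hτ x).symm
      rw [h2, KForm.pullback_comp _ (hsm t ht τ hτ) (hsm ε hε t ht)]
      rfl
    have h1 := hJ.is_const_of_deriv_eq_zero hJ'.isPreconnected
      (fun t ht => (hder t ht).differentiableAt.differentiableWithinAt)
      (fun t ht => (hder t ht).deriv) hε hJ0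
    have h2 : P ε ε = id := funext (h0 ε hε)
    simp only [h2, KForm.pullback_id, hα.zero] at h1
    exact h1

end LieGroupoid

/-! ### Smoothness of the velocity fields of a family of diffeomorphisms -/

section Velocity

open Filter Topology

/-- The solution of a smooth family of linear equations given by the partial derivatives of a smooth
map is smooth. -/
theorem ContDiffAt.inverse_fderiv_inr {E : Type u} [NormedAddCommGroup E] [NormedSpace ℝ E]
    [CompleteSpace E] {F : ℝ × E → E} {p : ℝ × E} (hF : ContDiffAt ℝ ∞ F p) {e : E ≃L[ℝ] E}
    (he : (e : E →L[ℝ] E) = fderiv ℝ F p ∘L ContinuousLinearMap.inr ℝ ℝ E) :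
    ContDiffAt ℝ ∞ (fun q => (fderiv ℝ F q ∘L ContinuousLinearMap.inr ℝ ℝ E).inverse
      (fderiv ℝ F q (1, 0))) p ∧
    ∀ᶠ q in 𝓝 p, (fderiv ℝ F q ∘L ContinuousLinearMap.inr ℝ ℝ E).IsInvertible := by
  have h1 : ContDiffAt ℝ ∞ (fderiv ℝ F) p := hF.fderiv_right (by simp)
  have h2 : ContDiffAt ℝ ∞ (fun q => fderiv ℝ F q ∘L ContinuousLinearMap.inr ℝ ℝ E) p :=
    h1.clm_comp contDiffAt_const
  refine ⟨?_, ?_⟩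
  · refine ContDiffAt.clm_apply ?_ (h1.clm_apply contDiffAt_const)
    refine ContDiffAt.comp p (g := ContinuousLinearMap.inverse) ?_ h2
    rw [← he]
    exact contDiffAt_map_inverse e
  · have h3 := h2.continuousAt.eventually_mem (s := range ((↑) : (E ≃L[ℝ] E) → E →L[ℝ] E))
      (by rw [← he]; exact e.nhds)
    exact h3

variable {E : Type u} [NormedAddCommGroup E] [NormedSpace ℝ E]
  {G : Type w₁} [TopologicalSpace G] [ChartedSpace E G] [IsManifold 𝓘(ℝ, E) ∞ G]

/-- The vector fields obtained by transporting the velocities of a smooth family of maps with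
invertible derivatives back by these derivatives form a smooth family. -/
theorem isSmoothVectorFieldFamily_of_velocity [CompleteSpace E] {J : Set ℝ} (hJ : IsOpen J)
    {Φ : ℝ → G → G} (hΦ : ContMDiffOn (𝓘(ℝ, ℝ).prod 𝓘(ℝ, E)) 𝓘(ℝ, E) ∞
      (fun q : ℝ × G => Φ q.1 q.2) (J ×ˢ univ))
    (hΦ' : ∀ ε ∈ J, ∀ g, ∃ e : E ≃L[ℝ] E,
      (e : E →L[ℝ] E) = (mfderiv 𝓘(ℝ, E) 𝓘(ℝ, E) (Φ ε) g : E →L[ℝ] E))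
    {Z : ℝ → (g : G) → TangentSpace 𝓘(ℝ, E) g}
    (hZ : ∀ ε ∈ J, ∀ g, HasMFDerivAt 𝓘(ℝ, ℝ) 𝓘(ℝ, E) (fun τ => Φ τ g) ε
      (ContinuousLinearMap.toSpanSingleton ℝ
        ((mfderiv 𝓘(ℝ, E) 𝓘(ℝ, E) (Φ ε) g : E →L[ℝ] E) (Z ε g)))) :
    IsSmoothVectorFieldFamily J Z := by
  have : IsManifold 𝓘(ℝ, E) 1 G := .of_le (n := ∞) (by simp)
  rintro ⟨ε₀, g₀⟩ ⟨hε₀, -⟩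
  replace hε₀ : ε₀ ∈ J := hε₀
  let φ := extChartAt 𝓘(ℝ, E) g₀
  let ψ := extChartAt 𝓘(ℝ, E) (Φ ε₀ g₀)
  have hg₀ : g₀ ∈ φ.source := mem_extChartAt_source g₀
  have hφo : IsOpen φ.source := isOpen_extChartAt_source g₀
  have hψo : IsOpen ψ.source := isOpen_extChartAt_source _
  have hJo : IsOpen (J ×ˢ (univ : Set G)) := hJ.prod isOpen_univ
  have hΦat : ∀ ε ∈ J, ∀ g, ContMDiffAt (𝓘(ℝ, ℝ).prod 𝓘(ℝ, E)) 𝓘(ℝ, E) ∞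
      (fun q : ℝ × G => Φ q.1 q.2) (ε, g) := fun ε hε g =>
    hΦ.contMDiffAt (hJo.mem_nhds ⟨hε, mem_univ _⟩)
  have hΦd : ∀ ε ∈ J, ∀ g, HasMFDerivAt 𝓘(ℝ, E) 𝓘(ℝ, E) (Φ ε) g
      (mfderiv 𝓘(ℝ, E) 𝓘(ℝ, E) (Φ ε) g) := fun ε hε g =>
    (((hΦat ε hε g).comp g (f := fun x : G => (ε, x))
      (contMDiffAt_const.prodMk contMDiffAt_id)).mdifferentiableAt (by simp)).hasMFDerivAt
  let F : ℝ × E → E := fun p => ψ (Φ p.1 (φ.symm p.2))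
  have hF : ContDiffAt ℝ ∞ F (ε₀, φ g₀) := by
    have h1 : ContMDiffAt 𝓘(ℝ, ℝ × E) (𝓘(ℝ, ℝ).prod 𝓘(ℝ, E)) ∞
        (fun p : ℝ × E => (p.1, φ.symm p.2)) (ε₀, φ g₀) := by
      refine contDiff_fst.contMDiff.contMDiffAt.prodMk (ContMDiffAt.comp _ ?_
        contDiff_snd.contMDiff.contMDiffAt)
      exact (contMDiffOn_extChartAt_symm g₀).contMDiffAt
        (extChartAt_target_mem_nhds (I := 𝓘(ℝ, E)) g₀)
    have h2 : ContMDiffAt 𝓘(ℝ, ℝ × E) 𝓘(ℝ, E) ∞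
        (fun p : ℝ × E => Φ p.1 (φ.symm p.2)) (ε₀, φ g₀) :=
      ContMDiffAt.comp (ε₀, φ g₀) (g := fun q : ℝ × G => Φ q.1 q.2) (hΦat ε₀ hε₀ _) h1
    have h3 : ContMDiffAt 𝓘(ℝ, E) 𝓘(ℝ, E) ∞ ψ (Φ ε₀ (φ.symm (φ g₀))) := by
      rw [φ.left_inv hg₀]
      exact contMDiffAt_extChartAt
    exact (h3.comp (ε₀, φ g₀) h2).contDiffAt
  have hFd : ∀ᶠ p in 𝓝 (ε₀, φ g₀), HasFDerivAt F (fderiv ℝ F p) p :=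
    ((hF.of_le (m := 1) (by simp)).eventually (by simp)).mono fun p hp =>
      (hp.differentiableAt (by simp)).hasFDerivAt
  have hφd : ∀ x ∈ φ.source, HasMFDerivAt 𝓘(ℝ, E) 𝓘(ℝ, E) φ x (mfderiv 𝓘(ℝ, E) 𝓘(ℝ, E) φ x) :=
    fun x hx => (mdifferentiableAt_extChartAt (by rwa [← extChartAt_source 𝓘(ℝ, E)])).hasMFDerivAt
  have hψd : ∀ x ∈ ψ.source, HasMFDerivAt 𝓘(ℝ, E) 𝓘(ℝ, E) ψ x (mfderiv 𝓘(ℝ, E) 𝓘(ℝ, E) ψ x) :=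
    fun x hx => (mdifferentiableAt_extChartAt (by rwa [← extChartAt_source 𝓘(ℝ, E)])).hasMFDerivAt
  -- the two partial derivatives of the coordinate expression
  have hspace : ∀ ε ∈ J, ∀ g ∈ φ.source, Φ ε g ∈ ψ.source →
      HasFDerivAt F (fderiv ℝ F (ε, φ g)) (ε, φ g) →
      ((fderiv ℝ F (ε, φ g) ∘L ContinuousLinearMap.inr ℝ ℝ E) ∘L
        mfderiv 𝓘(ℝ, E) 𝓘(ℝ, E) φ g : E →L[ℝ] E) =
      (mfderiv 𝓘(ℝ, E) 𝓘(ℝ, E) ψ (Φ ε g) ∘L mfderiv 𝓘(ℝ, E) 𝓘(ℝ, E) (Φ ε) g : E →L[ℝ] E) := by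
    intro ε hε g hg hεg h
    have h1 : HasMFDerivAt 𝓘(ℝ, E) 𝓘(ℝ, E) (fun x => F (ε, φ x)) g
        ((fderiv ℝ F (ε, φ g) ∘L ContinuousLinearMap.inr ℝ ℝ E) ∘L
          mfderiv 𝓘(ℝ, E) 𝓘(ℝ, E) φ g : E →L[ℝ] E) :=
      (h.comp (φ g) (hasFDerivAt_prodMk_right ε (φ g))).hasMFDerivAt.comp g (hφd g hg)
    have h2 : HasMFDerivAt 𝓘(ℝ, E) 𝓘(ℝ, E) (fun x => ψ (Φ ε x)) g
        (mfderiv 𝓘(ℝ, E) 𝓘(ℝ, E) ψ (Φ ε g) ∘L mfderiv 𝓘(ℝ, E) 𝓘(ℝ, E) (Φ ε) g : E →L[ℝ] E) :=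
      (hψd _ hεg).comp g (hΦd ε hε g)
    refine hasMFDerivAt_unique h1 (h2.congr_of_eventuallyEq ?_)
    filter_upwards [hφo.mem_nhds hg] with x hx
    change ψ (Φ ε (φ.symm (φ x))) = ψ (Φ ε x)
    rw [φ.left_inv hx]
  have htime : ∀ ε ∈ J, ∀ g ∈ φ.source, Φ ε g ∈ ψ.source →
      HasFDerivAt F (fderiv ℝ F (ε, φ g)) (ε, φ g) → fderiv ℝ F (ε, φ g) (1, 0) =
      (mfderiv 𝓘(ℝ, E) 𝓘(ℝ, E) ψ (Φ ε g) : E →L[ℝ] E)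
        ((mfderiv 𝓘(ℝ, E) 𝓘(ℝ, E) (Φ ε) g : E →L[ℝ] E) (Z ε g)) := by
    intro ε hε g hg hεg h
    have h1 : HasDerivAt (fun τ => F (τ, φ g)) (fderiv ℝ F (ε, φ g) (1, 0)) ε := by
      have := h.comp_hasDerivAt ε ((hasDerivAt_id ε).prodMk (hasDerivAt_const ε (φ g)))
      exact this
    have h2 := hasDerivAt_extChartAt_comp (x := Φ ε₀ g₀) (hZ ε hε g) hεg
    refine h1.unique (h2.congr_of_eventuallyEq (Eventually.of_forall fun τ => ?_))
    change ψ (Φ τ (φ.symm (φ g))) = ψ (Φ τ g)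
    rw [φ.left_inv hg]
  obtain ⟨e, he⟩ := hΦ' ε₀ hε₀ g₀
  have he' : (e : E →L[ℝ] E) = fderiv ℝ F (ε₀, φ g₀) ∘L ContinuousLinearMap.inr ℝ ℝ E := by
    have h1 := hspace ε₀ hε₀ g₀ hg₀ (mem_extChartAt_source _) hFd.self_of_nhds
    have h2 : mfderiv 𝓘(ℝ, E) 𝓘(ℝ, E) φ g₀ = ContinuousLinearMap.id ℝ E :=
      mfderiv_extChartAt_self
    have h3 : mfderiv 𝓘(ℝ, E) 𝓘(ℝ, E) ψ (Φ ε₀ g₀) = ContinuousLinearMap.id ℝ E :=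
      mfderiv_extChartAt_self
    rw [h2, h3] at h1
    exact he.trans h1.symm
  obtain ⟨hs, hinv⟩ := hF.inverse_fderiv_inr he'
  -- the coordinate expression of the vector fields
  have hc : Tendsto (fun q : ℝ × G => (q.1, φ q.2)) (𝓝 (ε₀, g₀)) (𝓝 (ε₀, φ g₀)) :=
    continuousAt_fst.prodMk (ContinuousAt.comp (x := (ε₀, g₀)) (f := Prod.snd) (g := φ)
      (continuousAt_extChartAt g₀) continuousAt_snd)
  have hcoord : ∀ᶠ q : ℝ × G in 𝓝 (ε₀, g₀),
      (trivializationAt E (TangentSpace 𝓘(ℝ, E)) g₀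
        (⟨q.2, Z q.1 q.2⟩ : TangentBundle 𝓘(ℝ, E) G)).2 =
      (fderiv ℝ F (q.1, φ q.2) ∘L ContinuousLinearMap.inr ℝ ℝ E).inverse
        (fderiv ℝ F (q.1, φ q.2) (1, 0)) := by
    filter_upwards [hc.eventually hFd, hc.eventually hinv,
      continuousAt_fst.eventually_mem (hJ.mem_nhds hε₀),
      continuousAt_snd.eventually_mem (hφo.mem_nhds hg₀),
      (hΦat ε₀ hε₀ g₀).continuousAt.eventually_mem (hψo.mem_nhds (mem_extChartAt_source _))]
      with ⟨ε, g⟩ h1 h2 h3 h4 h5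
    rw [trivializationAt_tangentBundle_snd _ (by rwa [← extChartAt_source 𝓘(ℝ, E)])]
    -- In charts the time derivative of `F` is `Tψ (TΦ Z)`, and its space derivative composed with
    -- `Tφ` is `Tψ ∘ TΦ`; hence `Tφ Z` is the inverse of the space derivative applied to the time
    -- derivative.
    refine Eq.symm (h2.inverse_apply_eq.2 ?_)
    refine (htime ε h3 g h4 h5 h1).trans ?_
    exact congrArg (fun L : E →L[ℝ] E => L (Z ε g)) (hspace ε h3 g h4 h5 h1).symm
  refine (Bundle.contMDiffAt_totalSpace.2 ⟨contMDiffAt_snd, ?_⟩).contMDiffWithinAt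
  refine ContMDiffAt.congr_of_eventuallyEq ?_ hcoord
  refine ContMDiffAt.comp (ε₀, g₀) (f := fun q : ℝ × G => (q.1, φ q.2)) (I' := 𝓘(ℝ, ℝ × E))
    hs.contMDiffAt ?_
  exact contMDiffAt_fst.prodMk_space (ContMDiffAt.comp (ε₀, g₀) (f := Prod.snd) (g := φ)
    contMDiffAt_extChartAt contMDiffAt_snd)

end Velocity

/-- Curves have at most one velocity. -/
theorem hasMFDerivAt_toSpanSingleton_unique {E : Type u} [NormedAddCommGroup E] [NormedSpace ℝ E]
    {X : Type w₁} [TopologicalSpace X] [ChartedSpace E X] {γ : ℝ → X} {t : ℝ} {v w : E}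
    (hv : HasMFDerivAt 𝓘(ℝ, ℝ) 𝓘(ℝ, E) γ t (ContinuousLinearMap.toSpanSingleton ℝ v))
    (hw : HasMFDerivAt 𝓘(ℝ, ℝ) 𝓘(ℝ, E) γ t (ContinuousLinearMap.toSpanSingleton ℝ w)) : v = w := by
  have h : ContinuousLinearMap.toSpanSingleton ℝ v = ContinuousLinearMap.toSpanSingleton ℝ w :=
    hasMFDerivAt_unique hv hw
  simpa using congrArg (fun L : ℝ →L[ℝ] E => L 1) h

/-! ### Families of automorphisms have multiplicative velocities -/

namespace LieGroupoid

open Filter Topology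

variable {E : Type u} [NormedAddCommGroup E] [NormedSpace ℝ E]
  {E₀ : Type v} [NormedAddCommGroup E₀] [NormedSpace ℝ E₀]
  {G : Type w₁} [TopologicalSpace G] [ChartedSpace E G]
  {M : Type w₂} [TopologicalSpace M] [ChartedSpace E₀ M]
  {𝒢 : LieGroupoid E E₀ G M} {J : Set ℝ}

theorem IsAutomorphism.src_eq {Φ : G → G} (hΦ : 𝒢.IsAutomorphism Φ) {a b : G}
    (h : 𝒢.src a = 𝒢.src b) : 𝒢.src (Φ a) = 𝒢.src (Φ b) := by
  obtain ⟨_, f, -, hs, -, -⟩ := hΦ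
  rw [hs, hs, h]

theorem IsAutomorphism.div_mul {Φ : G → G} (hΦ : 𝒢.IsAutomorphism Φ) {g h : G}
    (e : 𝒢.src g = 𝒢.tgt h) : 𝒢.div (Φ (𝒢.mul g h), Φ h) = Φ g := by
  obtain ⟨_, f, -, hs, ht, hm⟩ := hΦ
  rw [hm g h e, 𝒢.mul_div_cancel (by rw [hs, ht, e])]

/-- The automorphisms carry the inverse with them. -/
theorem IsAutomorphism.exists_inverse {Φ : G → G} (hΦ : 𝒢.IsAutomorphism Φ) :
    ∃ F : G ≃ₘ^∞⟮𝓘(ℝ, E), 𝓘(ℝ, E)⟯ G, (∀ g, Φ g = F g) ∧ 𝒢.IsAutomorphism F.symm := by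
  obtain ⟨F, f, hF, hs, ht, hm⟩ := hΦ
  simp only [hF] at hs ht hm
  have hs' : ∀ g, 𝒢.src (F.symm g) = f.symm (𝒢.src g) := fun g => by
    rw [← f.symm_apply_apply (𝒢.src (F.symm g)), ← hs, F.apply_symm_apply]
  have ht' : ∀ g, 𝒢.tgt (F.symm g) = f.symm (𝒢.tgt g) := fun g => by
    rw [← f.symm_apply_apply (𝒢.tgt (F.symm g)), ← ht, F.apply_symm_apply]
  refine ⟨F, hF, F.symm, f.symm, fun _ => rfl, hs', ht', fun g h e => ?_⟩
  rw [← F.symm_apply_apply (𝒢.mul (F.symm g) (F.symm h)), hm _ _ (by rw [hs', ht', e]),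
    F.apply_symm_apply, F.apply_symm_apply]

theorem IsAutomorphism.comp {Φ Ψ : G → G} (hΦ : 𝒢.IsAutomorphism Φ) (hΨ : 𝒢.IsAutomorphism Ψ) :
    𝒢.IsAutomorphism fun g => Φ (Ψ g) := by
  obtain ⟨F, f, hF, hs, ht, hm⟩ := hΦ
  obtain ⟨F', f', hF', hs', ht', hm'⟩ := hΨ
  refine ⟨F'.trans F, f'.trans f, fun g => by simp [hF, hF'], fun g => by simp [hs, hs'],
    fun g => by simp [ht, ht'], fun g h e => ?_⟩
  simp only [hm' g h e]
  exact hm _ _ (by rw [hs', ht', e])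

/-- The velocity, at a time when it passes through the identity, of a curve of automorphisms is a
multiplicative vector field. -/
theorem isDeformationCocycle_of_velocity {Ψ : ℝ → G → G} {t : ℝ}
    (hΨ : ∀ᶠ τ in 𝓝 t, 𝒢.IsAutomorphism (Ψ τ)) (h0 : ∀ g, Ψ t g = g)
    {Z : (g : G) → TangentSpace 𝓘(ℝ, E) g}
    (hZ : ∀ g, HasMFDerivAt 𝓘(ℝ, ℝ) 𝓘(ℝ, E) (fun τ => Ψ τ g) t
      (ContinuousLinearMap.toSpanSingleton ℝ (Z g : E))) : 𝒢.IsDeformationCocycle Z := by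
  refine ⟨⟨𝒢.baseField Z, fun g => ?_⟩, fun g h e => ?_⟩
  · have hc : ∀ a : G, HasMFDerivAt 𝓘(ℝ, ℝ) 𝓘(ℝ, E₀) (fun τ => 𝒢.src (Ψ τ a)) t
        (ContinuousLinearMap.toSpanSingleton ℝ
          ((mfderiv 𝓘(ℝ, E) 𝓘(ℝ, E₀) 𝒢.src a : E →L[ℝ] E₀) (Z a))) := by
      intro a
      have h1 := (hZ a).comp_curve
        ((𝒢.contMDiff_src.mdifferentiable (by simp)) (Ψ t a)).hasMFDerivAt
      exact h1.congr_mfderiv (congrArg (fun y => ContinuousLinearMap.toSpanSingleton ℝ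
        ((mfderiv 𝓘(ℝ, E) 𝓘(ℝ, E₀) 𝒢.src y : E →L[ℝ] E₀) (Z a))) (h0 a))
    -- Since `g` and the unit at its source have the same source, so do their images; the two
    -- projected curves coincide and have equal velocities.
    have h1 := (hc (𝒢.unit (𝒢.src g))).congr_of_eventuallyEq (f₁ := fun τ => 𝒢.src (Ψ τ g))
      (hΨ.mono fun τ hτ => hτ.src_eq (𝒢.src_unit _).symm)
    exact hasMFDerivAt_toSpanSingleton_unique (E := E₀) (hc g) h1
  · have hdiv : ∀ a b : G, ∀ c d : G, c = a → d = b →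
        (mfderivWithin (𝓘(ℝ, E).prod 𝓘(ℝ, E)) 𝓘(ℝ, E) 𝒢.div 𝒢.divisible (c, d)
          ((Z a, Z b) : E × E) : E) =
        mfderivWithin (𝓘(ℝ, E).prod 𝓘(ℝ, E)) 𝓘(ℝ, E) 𝒢.div 𝒢.divisible (a, b)
          ((Z a, Z b) : E × E) := by
      rintro a b _ _ rfl rfl
      rfl
    have h1 := 𝒢.hasMFDerivAt_div (hZ (𝒢.mul g h)) (hZ h)
      (hΨ.mono fun τ hτ => hτ.src_eq (𝒢.src_mul g h e))
    -- Differentiating the identity that the quotient of `Ψ τ (g h)` by `Ψ τ h` is `Ψ τ g` gives the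
    -- cocycle condition.
    have h2 := (hZ g).congr_of_eventuallyEq
      (f₁ := fun τ => 𝒢.div (Ψ τ (𝒢.mul g h), Ψ τ h)) (hΨ.mono fun τ hτ => hτ.div_mul e)
    have h3 := hasMFDerivAt_toSpanSingleton_unique h1 h2
    have h4 := (hdiv _ _ _ _ (h0 (𝒢.mul g h)) (h0 h)).symm.trans h3
    have h5 : ∀ (x y : G) (v w : E), x = y → v = w →
        (⟨x, v⟩ : TangentBundle 𝓘(ℝ, E) G) = ⟨y, w⟩ := by
      rintro x _ v _ rfl rfl
      rfl
    exact h5 _ _ _ _ (𝒢.mul_div_cancel e) h4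

variable [IsManifold 𝓘(ℝ, E) ∞ G] {k : ℕ}

/-- A family of automorphisms that generates the deformation has velocities that are primitives of
the derivative of the deformation. -/
theorem IsDeformation.exists_isDeformationCocycle [CompleteSpace E] (hJ : IsOpen J)
    {α₀ : KForm E G k} {α : ℝ → KForm E G k} (hα : 𝒢.IsDeformation J α₀ α) {Φ : ℝ → G → G}
    (hΦ : 𝒢.IsSmoothAutomorphismFamily J Φ) (hd : ∀ ε ∈ J, α ε = α₀.pullback (Φ ε)) :
    ∃ Z : ℝ → (g : G) → TangentSpace 𝓘(ℝ, E) g,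
      IsSmoothVectorFieldFamily J Z ∧ (∀ ε ∈ J, 𝒢.IsDeformationCocycle (Z ε)) ∧
      ∀ ε ∈ J, ∀ (g : G) (v : Fin k → TangentSpace 𝓘(ℝ, E) g),
        (α ε).push (tangentPowerLift k (Z ε)) ⟨g, v⟩ = deriv (fun τ => α τ g v) ε := by
  obtain ⟨hsm, haut⟩ := hΦ
  have hat : ∀ ε ∈ J, ∀ g, ContMDiffAt (𝓘(ℝ, ℝ).prod 𝓘(ℝ, E)) 𝓘(ℝ, E) ∞
      (fun q : ℝ × G => Φ q.1 q.2) (ε, g) := fun ε hε g =>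
    hsm.contMDiffAt ((hJ.prod isOpen_univ).mem_nhds ⟨hε, mem_univ _⟩)
  have hvel : ∀ ε ∈ J, ∀ g, HasMFDerivAt 𝓘(ℝ, ℝ) 𝓘(ℝ, E) (fun τ => Φ τ g) ε
      (ContinuousLinearMap.toSpanSingleton ℝ
        ((mfderiv 𝓘(ℝ, ℝ) 𝓘(ℝ, E) (fun τ => Φ τ g) ε : ℝ →L[ℝ] E) 1)) := by
    intro ε hε g
    have h1 := (((hat ε hε g).comp ε (f := fun τ : ℝ => (τ, g))
      (contMDiffAt_id.prodMk contMDiffAt_const)).mdifferentiableAt (by simp)).hasMFDerivAt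
    refine h1.congr_mfderiv ?_
    exact ContinuousLinearMap.ext_ring (one_smul ℝ _).symm
  have hinv : ∀ ε ∈ J, ∀ g, ∃ e : E ≃L[ℝ] E,
      (e : E →L[ℝ] E) = (mfderiv 𝓘(ℝ, E) 𝓘(ℝ, E) (Φ ε) g : E →L[ℝ] E) := by
    intro ε hε g
    obtain ⟨F, hF, -⟩ := (haut ε hε).exists_inverse
    rw [show Φ ε = F from funext hF]
    exact ⟨F.mfderivToContinuousLinearEquiv (by simp) g, rfl⟩
  -- The velocity is transported back to `g` by `TΦ ε`. For `ε ∈ J` the derivative is invertible, so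
  -- the default value of `inverse` plays no role there.
  let Z : ℝ → (g : G) → TangentSpace 𝓘(ℝ, E) g := fun ε g =>
    (mfderiv 𝓘(ℝ, E) 𝓘(ℝ, E) (Φ ε) g : E →L[ℝ] E).inverse
      ((mfderiv 𝓘(ℝ, ℝ) 𝓘(ℝ, E) (fun τ => Φ τ g) ε : ℝ →L[ℝ] E) 1)
  have hZ : ∀ ε ∈ J, ∀ g, HasMFDerivAt 𝓘(ℝ, ℝ) 𝓘(ℝ, E) (fun τ => Φ τ g) ε
      (ContinuousLinearMap.toSpanSingleton ℝ
        ((mfderiv 𝓘(ℝ, E) 𝓘(ℝ, E) (Φ ε) g : E →L[ℝ] E) (Z ε g))) := by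
    intro ε hε g
    obtain ⟨e, he⟩ := hinv ε hε g
    refine (hvel ε hε g).congr_mfderiv (congrArg (ContinuousLinearMap.toSpanSingleton ℝ) ?_)
    exact (ContinuousLinearMap.IsInvertible.inverse_apply_eq ⟨e, he⟩).1 rfl
  -- The family is `Ψ τ = (Φ ε)⁻¹ ∘ Φ τ`, recentred to pass through the identity at `τ = ε`.
  have hpre : ∀ ε ∈ J, ∃ Ψ : ℝ → G → G, (∀ τ ∈ J, 𝒢.IsAutomorphism (Ψ τ)) ∧ (∀ g, Ψ ε g = g) ∧
      (∀ g, HasMFDerivAt 𝓘(ℝ, ℝ) 𝓘(ℝ, E) (fun τ => Ψ τ g) ε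
        (ContinuousLinearMap.toSpanSingleton ℝ (Z ε g : E))) ∧
      (∀ g, ContMDiffAt (𝓘(ℝ, ℝ).prod 𝓘(ℝ, E)) 𝓘(ℝ, E) ∞ (fun q : ℝ × G => Ψ q.1 q.2) (ε, g)) ∧
      ∀ τ, Φ τ = Φ ε ∘ Ψ τ := by
    intro ε hε
    obtain ⟨F, hF, hF'⟩ := (haut ε hε).exists_inverse
    refine ⟨fun τ g => F.symm (Φ τ g), fun τ hτ => hF'.comp (haut τ hτ), fun g => ?_, fun g => ?_,
      fun g => ?_, fun τ => funext fun g => ?_⟩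
    · simp only [hF, F.symm_apply_apply]
    · have h1 := (hZ ε hε g).comp_curve
        (F.symm.mdifferentiable (by simp) (Φ ε g)).hasMFDerivAt
      refine h1.congr_mfderiv (congrArg (ContinuousLinearMap.toSpanSingleton ℝ) ?_)
      have h2 : HasMFDerivAt 𝓘(ℝ, E) 𝓘(ℝ, E) (fun x => F.symm (Φ ε x)) g
          (mfderiv 𝓘(ℝ, E) 𝓘(ℝ, E) F.symm (Φ ε g) ∘L mfderiv 𝓘(ℝ, E) 𝓘(ℝ, E) (Φ ε) g :
            E →L[ℝ] E) := by
        refine HasMFDerivAt.comp g (F.symm.mdifferentiable (by simp) (Φ ε g)).hasMFDerivAt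
          (MDifferentiableAt.hasMFDerivAt ?_)
        rw [show Φ ε = F from funext hF]
        exact F.mdifferentiable (by simp) g
      have h3 : (fun x => F.symm (Φ ε x)) = id := funext fun x => by
        rw [hF, F.symm_apply_apply]
        rfl
      rw [h3] at h2
      exact congrArg (fun L : E →L[ℝ] E => L (Z ε g)) (hasMFDerivAt_unique h2 (hasMFDerivAt_id g))
    · exact ContMDiffAt.comp (ε, g) (g := F.symm) F.symm.contMDiff.contMDiffAt (hat ε hε g)
    · simp only [Function.comp_apply, hF, F.apply_symm_apply]
  refine ⟨Z, isSmoothVectorFieldFamily_of_velocity hJ hsm hinv hZ, fun ε hε => ?_,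
    fun ε hε g v => ?_⟩
  · obtain ⟨Ψ, hΨ, h0, hΨZ, -, -⟩ := hpre ε hε
    exact isDeformationCocycle_of_velocity (eventually_of_mem (hJ.mem_nhds hε) hΨ) h0 hΨZ
  · obtain ⟨Ψ, hΨ, h0, hΨZ, hΨsm, hcomp⟩ := hpre ε hε
    -- Near `ε` one has `α τ = (Ψ τ)^* α ε`; with the form `α ε` frozen, the derivative formula
    -- leaves only the Lie derivative term.
    have hconst : IsSmoothFormFamily univ fun _ : ℝ => α ε := by
      have h1 : ContMDiffOn _ _ _ _ _ := hα.smooth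
      exact h1.comp (f := fun q : ℝ × TangentPower E G k => (ε, q.2))
        (contMDiff_const.prodMk contMDiff_snd).contMDiffOn fun q _ => ⟨hε, mem_univ _⟩
    have h1 := hconst.hasDerivAt_pullback isOpen_univ (mem_univ ε) (hΨsm g) h0 hΨZ v
    rw [deriv_const, zero_add] at h1
    refine (h1.congr_of_eventuallyEq ?_).deriv.symm
    filter_upwards [hJ.mem_nhds hε] with τ hτ
    have hm : ∀ {Ψ : G → G}, 𝒢.IsAutomorphism Ψ → MDifferentiable 𝓘(ℝ, E) 𝓘(ℝ, E) Ψ := by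
      rintro Ψ ⟨F, _, hF, -⟩
      rw [show Ψ = F from funext hF]
      exact F.mdifferentiable (by simp)
    rw [hd τ hτ, hd ε hε, hcomp τ, KForm.pullback_comp _ (hm (haut ε hε)) (hm (hΨ τ hτ))]

end LieGroupoid

end

/-! ### The equivalence -/

theorem mainTheorem12
    {E : Type*} [NormedAddCommGroup E] [NormedSpace ℝ E] [FiniteDimensional ℝ E]
    {E₀ : Type*} [NormedAddCommGroup E₀] [NormedSpace ℝ E₀] [FiniteDimensional ℝ E₀]
    {G : Type*} [TopologicalSpace G] [ChartedSpace E G] [IsManifold 𝓘(ℝ, E) ∞ G]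
    {M : Type*} [TopologicalSpace M] [ChartedSpace E₀ M] [IsManifold 𝓘(ℝ, E₀) ∞ M]
    (𝒢 : LieGroupoid E E₀ G M) [CompactSpace G] [T2Space G]
    {k : ℕ} {J : Set ℝ} (hJ : IsOpen J) (hJ' : J.OrdConnected) (h0 : (0 : ℝ) ∈ J)
    (α₀ : KForm E G k) (α : ℝ → KForm E G k) (hα : 𝒢.IsDeformation J α₀ α) :
    (∃ Φ : ℝ → G → G, 𝒢.IsSmoothAutomorphismFamily J Φ ∧ (∀ g, Φ 0 g = g) ∧
        ∀ ε ∈ J, α ε = α₀.pullback (Φ ε)) ↔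
      ∃ Z : ℝ → (g : G) → TangentSpace 𝓘(ℝ, E) g,
        IsSmoothVectorFieldFamily J Z ∧ (∀ ε ∈ J, 𝒢.IsDeformationCocycle (Z ε)) ∧
        ∀ ε ∈ J, ∀ (g : G) (v : Fin k → TangentSpace 𝓘(ℝ, E) g),
          (α ε).push (tangentPowerLift k (Z ε)) ⟨g, v⟩ = deriv (fun τ => α τ g v) ε := by
  refine ⟨fun ⟨Φ, hΦ, _, hd⟩ => ?_, fun ⟨Z, hZ, hc, hd⟩ => ?_⟩
  · have := FiniteDimensional.complete ℝ E
    exact hα.exists_isDeformationCocycle hJ hΦ hd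
  · exact hα.exists_isSmoothAutomorphismFamily hJ hJ' h0 hZ hc hd
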